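/- For an integer $k\ge 3$ let $m$ be an even integer with $|m-\log k|\le 1$ and let $w$ be an integer with $|w-k/\log\log k|<1$ (so $m=\log k$ and $w=k/\log\log k$ up to rounding; $\log$ is to base 2). Consider the following communication problem. Alice's exact input consists of a string $x\in\{0,1\}^k$, unit vectors $v_1,\dots,v_k\in\mathbb R^m$, and $m/2$-dimensional subspaces $S_1,\dots,S_k$ of $\mathbb R^m$; Bob's consists of a string $y\in\{0,1\}^k$ and real $m\times m$ unitary (i.e. orthogonal) matrices $U_1,\dots,U_k$. It is promised that $x$ and $y$ differ in exactly $w$ positions, and that either $U_iv_i\in S_i$ for every $i$ with $x_i\ne y_i$ (then $f=0$), or $U_iv_i\in S_i^\perp$ for every $i$ with $x_i\neq y_i$ (then $f=1$). The inputs actually handed to the parties are finite: $x$, $y$ are given exactly, and the entries of the $v_i$, of some orthonormal basis of each $S_i$, and of the $U_i$ are given as $b$-bit numbers with additive error at most $2^{-b}$, where $b=c\lceil\log m\rceil$ for a fixed integer constant $c\ge2$. A pair of finite inputs satisfies the promise and has answer $0$ (resp. $1$) if it describes in this way some pair of exact inputs satisfying the promise with answer $0$ (resp. $1$). Let $n=k+km^2b=O(k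 m^2\log m)$ be the input length (the number of bits of the longer input, which is Bob's). Theorem. For every integer $c\ge 2$ there are constants $C,k_0$ such that for all $k\ge k_0$ and all $m,w$ as above: 1. no pair of finite inputs has both answers $0$ and $1$, so that the problem defines a Boolean function $f$ on the promise; 2. there is a 4-round (i.e. four alternating messages, the first one from Alice) public-coin quantum protocol without prior entanglement that computes $f$ with error probability at most $1/3$ on every input satisfying the promise, communicates at most $C\log\log n$ qubits in total, and uses at most $C\log n$ shared random bits; 3. $Q^{\parallel}(f)\le(\log n)^{C}$, where $Q^\parallel(f)$ is the least total number of qubits that Alice and Bob send to the referee in a simultaneous-message-passing quantum protocol without shared randomness or entanglement that computes $f$ with error probability at most $1/3$ on every input satisfying the promise. -/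

import Mathlib

open scoped Matrix ComplexOrder

/-! ## Communication problems -/

/-- Bit strings of length `q`; they also label the computational basis of `q` qubits. -/
abbrev Bits (q : ℕ) : Type := Fin q → Bool

/-- A Boolean promise problem with inputs `x : X` for Alice and `y : Y` for Bob:
`f x y b` says that `(x, y)` satisfies the promise and that the correct answer is `b`. -/
abbrev PromiseProblem (X Y : Type) : Type := X → Y → Bool → Prop

/-- Acceptance probabilities `p x y` (of the output `1`) solve `f` if on every input that satisfies
the promise the output is wrong with probability at most `1/3`. -/
def SolvesWithBoundedError {X Y : Type} (f : PromiseProblem X Y) (p : X → Y → ℝ) : Prop :=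
  ∀ x y, (f x y true → 2 / 3 ≤ p x y) ∧ (f x y false → p x y ≤ 1 / 3)

/-- `E` is the `accept' element of a two-outcome quantum measurement (POVM): `0 ≤ E ≤ 1`. -/
def IsEffect {α : Type} [DecidableEq α] (E : Matrix α α ℂ) : Prop :=
  E.PosSemidef ∧ (1 - E).PosSemidef

/-- `ρ` is a (possibly mixed) quantum state. -/
def IsDensity {α : Type} [Fintype α] (ρ : Matrix α α ℂ) : Prop :=
  ρ.PosSemidef ∧ ρ.trace = 1

/-! ## Interactive quantum protocols -/

/-- Two-party quantum protocols with alternating messages. In `QProtocol X Y α β` the player to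
move has input in `X` and a private register with basis `α`, the other one has input in `Y` and a
private register with basis `β`. The player to move either

* stops, and produces the output bit by a two-outcome measurement of her register, or
* applies to her register an isometry (a unitary with fresh ancillas) into a new private register
  with basis `α'` together with `q` message qubits. The message is sent, so it becomes a part of the
  register of the other player, who moves next. -/
inductive QProtocol : (X Y α β : Type) → Type 1
  | output {X Y α β : Type} [Fintype α] [DecidableEq α] [Fintype β]
      (E : X → Matrix α α ℂ) (hE : ∀ x, IsEffect (E x)) : QProtocol X Y α β
  | send {X Y α β : Type} [Fintype α] [DecidableEq α] (α' : Type) [Fintype α'] (q : ℕ)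
      (V : X → Matrix (α' × Bits q) α ℂ) (hV : ∀ x, (V x)ᴴ * V x = 1)
      (next : QProtocol Y X (β × Bits q) α') : QProtocol X Y α β

namespace QProtocol

/-- The number of messages (rounds). -/
def rounds : {X Y α β : Type} → QProtocol X Y α β → ℕ
  | _, _, _, _, output _ _ => 0
  | _, _, _, _, send _ _ _ _ next => next.rounds + 1

/-- The total number of qubits communicated. -/
def qubits : {X Y α β : Type} → QProtocol X Y α β → ℕ
  | _, _, _, _, output _ _ => 0
  | _, _, _, _, send _ q _ _ next => q + next.qubits

/-- The probability of the output `1` on inputs `x` (of the player to move) and `y`, when the joint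
pure state of the two registers has the amplitudes `ψ a b`. -/
noncomputable def acceptProb :
    {X Y α β : Type} → QProtocol X Y α β → X → Y → Matrix α β ℂ → ℝ
  | _, _, _, _, output E _, x, _, ψ => (ψᴴ * E x * ψ).trace.re
  | _, _, _, _, send _ _ V _ next, x, y, ψ =>
      next.acceptProb y x (fun bm a' => ∑ a, V x (a', bm.2) a * ψ a bm.1)

end QProtocol

/-- A public-coin quantum protocol with `ℓ` shared random bits and no prior entanglement: the shared
string selects a quantum protocol in which Alice moves first and all registers are initially empty
(one-dimensional). -/
abbrev PublicCoinQProtocol (X Y : Type) (ℓ : ℕ) : Type 1 := Bits ℓ → QProtocol X Y Unit Unit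

/-- The probability of the output `1`, over the shared random string and the measurement. -/
noncomputable def PublicCoinQProtocol.acceptProb {X Y : Type} {ℓ : ℕ}
    (P : PublicCoinQProtocol X Y ℓ) (x : X) (y : Y) : ℝ :=
  (∑ s, (P s).acceptProb x y (fun _ _ => 1)) / 2 ^ ℓ

/-- `f` has a bounded-error `r`-round public-coin quantum protocol that communicates at most `q`
qubits and uses `ℓ` shared random bits. -/
def HasPublicCoinQProtocol {X Y : Type} (f : PromiseProblem X Y) (r q ℓ : ℕ) : Prop :=
  ∃ P : PublicCoinQProtocol X Y ℓ,
    (∀ s, (P s).rounds = r ∧ (P s).qubits ≤ q) ∧ SolvesWithBoundedError f P.acceptProb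

/-! ## Simultaneous message passing -/

/-- A quantum SMP protocol without shared resources: Alice sends `qA` qubits and Bob `qB` qubits to
a referee, who measures them jointly. -/
structure QSMPProtocol (X Y : Type) (qA qB : ℕ) where
  alice : X → Matrix (Bits qA) (Bits qA) ℂ
  bob : Y → Matrix (Bits qB) (Bits qB) ℂ
  referee : Matrix (Bits qA × Bits qB) (Bits qA × Bits qB) ℂ
  alice_density : ∀ x, IsDensity (alice x)
  bob_density : ∀ y, IsDensity (bob y)
  referee_effect : IsEffect referee

/-- The probability that the referee outputs `1`. -/
noncomputable def QSMPProtocol.acceptProb {X Y : Type} {qA qB : ℕ} (P : QSMPProtocol X Y qA qB)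
    (x : X) (y : Y) : ℝ :=
  (P.referee * Matrix.kronecker (P.alice x) (P.bob y)).trace.re

/-- The bounded-error quantum SMP complexity `Q^∥(f)`: the least total number of qubits sent to the
referee (`⊤` if there is no protocol). -/
noncomputable def QPar {X Y : Type} (f : PromiseProblem X Y) : ℕ∞ :=
  sInf {c : ℕ∞ | ∃ (qA qB : ℕ) (P : QSMPProtocol X Y qA qB),
    SolvesWithBoundedError f P.acceptProb ∧ c = ((qA + qB : ℕ) : ℕ∞)}

/-! ## Many small copies of Raz's problem -/

/-- Alice's exact input: `x ∈ {0,1}^k`, unit vectors `v_i ∈ ℝ^m` and `m/2`-dimensional subspaces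
`S_i` of `ℝ^m`. -/
structure AliceExact (k m : ℕ) where
  x : Fin k → Bool
  v : Fin k → EuclideanSpace ℝ (Fin m)
  S : Fin k → Submodule ℝ (EuclideanSpace ℝ (Fin m))
  norm_v : ∀ i, ‖v i‖ = 1
  finrank_S : ∀ i, Module.finrank ℝ (S i) = m / 2

/-- Bob's exact input: `y ∈ {0,1}^k` and real unitary (that is, orthogonal) `m × m` matrices. -/
structure BobExact (k m : ℕ) where
  y : Fin k → Bool
  U : Fin k → Matrix (Fin m) (Fin m) ℝ
  U_orthogonal : ∀ i, U i ∈ Matrix.orthogonalGroup (Fin m) ℝ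

/-- The problem with continuous inputs. The promise is that `x` and `y` differ in exactly `w`
positions and that either `U_i v_i ∈ S_i` in all of these positions (answer `0`), or
`U_i v_i ∈ S_i^⊥` in all of these positions (answer `1`). -/
def ExactRaz {k m : ℕ} (w : ℕ) (A : AliceExact k m) (B : BobExact k m) (ans : Bool) : Prop :=
  (Finset.univ.filter fun i => A.x i ≠ B.y i).card = w ∧
    ∀ i, A.x i ≠ B.y i →
      Matrix.toEuclideanLin (B.U i) (A.v i) ∈ (if ans then (A.S i)ᗮ else A.S i)

/-- The number in `[-1, 1]` denoted by `s`: the midpoint of the interval with number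
`∑ 2^j s_j` among the `2^b` consecutive intervals of length `2 / 2^b` that make up `[-1, 1]`. -/
noncomputable def fixedPoint {b : ℕ} (s : Bits b) : ℝ :=
  -1 + (2 * (∑ j, if s j then (2 : ℝ) ^ (j : ℕ) else 0) + 1) / 2 ^ b

/-- `s` is a `b`-bit approximation of the number `t`. -/
def Approximates {b : ℕ} (s : Bits b) (t : ℝ) : Prop := |fixedPoint s - t| ≤ 1 / 2 ^ b

/-- Alice's finite input: a string, and `b`-bit numbers for the entries of her vectors and of bases
of her subspaces. -/
structure AliceInput (k m b : ℕ) where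
  x : Fin k → Bool
  v : Fin k → Fin m → Bits b
  S : Fin k → Fin (m / 2) → Fin m → Bits b

/-- Bob's finite input: a string, and `b`-bit numbers for the entries of his matrices. -/
structure BobInput (k m b : ℕ) where
  y : Fin k → Bool
  U : Fin k → Fin m → Fin m → Bits b

/-- The finite input `a` describes the exact input `A`; each subspace is described by the entries of
an orthonormal basis. -/
def AliceInput.Describes {k m b : ℕ} (a : AliceInput k m b) (A : AliceExact k m) : Prop :=
  a.x = A.x ∧
  (∀ i p, Approximates (a.v i p) (A.v i p)) ∧
  ∀ i, ∃ e : OrthonormalBasis (Fin (m / 2)) ℝ (A.S i),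
    ∀ j p, Approximates (a.S i j p) ((e j : EuclideanSpace ℝ (Fin m)) p)

/-- The finite input `a` describes the exact input `B`. -/
def BobInput.Describes {k m b : ℕ} (a : BobInput k m b) (B : BobExact k m) : Prop :=
  a.y = B.y ∧ ∀ i p p', Approximates (a.U i p p') (B.U i p p')

/-- The finite problem: the inputs describe exact inputs that satisfy the promise. -/
def ManyRaz (k m w b : ℕ) : PromiseProblem (AliceInput k m b) (BobInput k m b) :=
  fun a a' ans => ∃ (A : AliceExact k m) (B : BobExact k m),
    a.Describes A ∧ a'.Describes B ∧ ExactRaz w A B ans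

/-- The input length: the number of bits of Bob's input, which is the longer one. -/
def inputLength (k m b : ℕ) : ℕ := k + k * (m * (m * b))

theorem card_bobInput (k m b : ℕ) : Nat.card (BobInput k m b) = 2 ^ inputLength k m b := by
  have e : BobInput k m b ≃ (Fin k → Bool) × (Fin k → Fin m → Fin m → Bits b) :=
    ⟨fun a => (a.y, a.U), fun a => ⟨a.1, a.2⟩, fun _ => rfl, fun _ => rfl⟩
  rw [Nat.card_congr e]
  simp [inputLength, ← pow_mul, pow_add]
  ring_nf

theorem card_aliceInput_le (k m b : ℕ) (hm : 2 ≤ m) :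
    Nat.card (AliceInput k m b) ≤ 2 ^ inputLength k m b := by
  have e : AliceInput k m b ≃
      (Fin k → Bool) × (Fin k → Fin m → Bits b) × (Fin k → Fin (m / 2) → Fin m → Bits b) :=
    ⟨fun a => (a.x, a.v, a.S), fun a => ⟨a.1, a.2.1, a.2.2⟩, fun _ => rfl, fun _ => rfl⟩
  have h : Nat.card (AliceInput k m b) = 2 ^ (k + k * (m * b + m / 2 * (m * b))) := by
    rw [Nat.card_congr e]
    simp [← pow_mul, ← pow_add]
    ring
  rw [h, inputLength]
  refine Nat.pow_le_pow_right (by norm_num) (Nat.add_le_add_left (Nat.mul_le_mul_left k ?_) k)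
  have h1 : 1 + m / 2 ≤ m := by omega
  calc m * b + m / 2 * (m * b) = (1 + m / 2) * (m * b) := by ring
    _ ≤ m * (m * b) := Nat.mul_le_mul_right _ h1

/-!
Each party replaces the finite input by exact data that it describes: unit vectors `v i` and
matrices `E i` whose rows are an orthonormal basis of the `i`-th subspace for Alice, orthogonal
matrices `U i` for Bob. Two such readings differ by at most `2 / 2 ^ b ≤ 2 / m ^ 2` in every entry,
so the overlaps `‖E i (U i (v i))‖` change by `O(1 / m)` only (`overlap_le_add`). In the exact
data of the promise they are `1` or `0` where the strings differ; hence they are close to `1` or to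
`0` for the readings, too (`exists_readings`). As the strings do differ, the answer is well defined.

*Four rounds.* The shared bits are a pair `(α, β)` of elements of a field with `2 ^ L ≥ k` elements.
They select the `t = O(log log k)` pairwise independent positions `α u_j + β`, and as the strings
differ in a fraction of about `1 / log log k` of all positions, Chebyshev's inequality shows that
they differ in one of those selected, with probability at least `5 / 6` (`exists_sampler`). The
parties exchange their bits in the selected positions and choose a position `i` where they differ;
then Alice sends the state `v i` in `clog m` qubits, Bob returns `U i (v i)`, and Alice measures
whether it is in her subspace (`hasPublicCoinQProtocol_manyRaz`).

*Simultaneous messages.* The sum of the squared overlaps over the positions where the strings differ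
is the inner product of a vector of Alice's and a vector of Bob's, in dimension `2 k m ^ 4`
(`sum_aliceVector_mul_bobVector`). After normalization the inner products for the two answers differ
by an inverse polynomial in `m`, which the referee detects by swap tests on polynomially (in `m`)
many copies of the two states (`qPar_le_of_inner_gap`). As `m` is about `log k`, the cost is
polylogarithmic.
-/

/-! ### Tensor powers -/

namespace Matrix

variable {ι α κ : Type} [Fintype ι]

/-- The tensor product `⨂ i, M i` of a family of square matrices. -/
def piKronecker (M : ι → Matrix α α ℂ) : Matrix (ι → α) (ι → α) ℂ :=
  fun f g => ∏ i, M i (f i) (g i)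

theorem piKronecker_mul [DecidableEq ι] [Fintype α] (M N : ι → Matrix α α ℂ) :
    piKronecker M * piKronecker N = piKronecker fun i => M i * N i := by
  ext f g
  simp only [piKronecker, mul_apply, ← Finset.prod_mul_distrib]
  rw [Finset.prod_univ_sum, Fintype.piFinset_univ]

theorem trace_piKronecker [DecidableEq ι] [Fintype α] (M : ι → Matrix α α ℂ) :
    (piKronecker M).trace = ∏ i, (M i).trace := by
  simp only [trace, diag, piKronecker]
  rw [Finset.prod_univ_sum, Fintype.piFinset_univ]

theorem piKronecker_one [DecidableEq α] :
    piKronecker (fun _ : ι => (1 : Matrix α α ℂ)) = 1 := by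
  ext f g
  by_cases h : f = g
  · subst h; simp [piKronecker]
  · obtain ⟨i, hi⟩ := Function.ne_iff.mp h
    rw [one_apply_ne h]
    exact Finset.prod_eq_zero (Finset.mem_univ i) (one_apply_ne hi)

theorem conjTranspose_piKronecker (M : ι → Matrix α α ℂ) :
    (piKronecker M)ᴴ = piKronecker fun i => (M i)ᴴ := by
  ext f g
  simp [piKronecker]

open scoped MatrixOrder in
theorem posSemidef_piKronecker [DecidableEq ι] [Fintype α] [DecidableEq α]
    {M : ι → Matrix α α ℂ} (hM : ∀ i, (M i).PosSemidef) : (piKronecker M).PosSemidef := by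
  choose B hB using fun i => (CStarAlgebra.nonneg_iff_eq_star_mul_self (a := M i)).mp (hM i).nonneg
  have : piKronecker M = (piKronecker B)ᴴ * piKronecker B := by
    rw [conjTranspose_piKronecker, piKronecker_mul]
    exact congrArg _ (funext hB)
  rw [this]
  exact posSemidef_conjTranspose_mul_self _

theorem sum_piKronecker [DecidableEq ι] [Fintype κ] (Q : κ → Matrix α α ℂ) :
    ∑ s : ι → κ, piKronecker (fun i => Q (s i)) = piKronecker fun _ => ∑ c, Q c := by
  ext f g
  simp only [piKronecker, sum_apply]
  rw [Finset.prod_univ_sum, Fintype.piFinset_univ]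

end Matrix

open Matrix

theorem posSemidef_of_projection {α : Type} [Fintype α] {P : Matrix α α ℂ} (h1 : Pᴴ = P)
    (h2 : P * P = P) : P.PosSemidef := by
  have := posSemidef_conjTranspose_mul_self P
  rwa [h1, h2] at this

theorem isEffect_of_projection {α : Type} [Fintype α] [DecidableEq α] {P : Matrix α α ℂ}
    (h1 : Pᴴ = P) (h2 : P * P = P) : IsEffect P := by
  refine ⟨posSemidef_of_projection h1 h2, posSemidef_of_projection ?_ ?_⟩
  · simp [h1]
  · simp [mul_sub, sub_mul, h2]

/-! ### The swap test -/

section SwapTest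

variable {D : Type} [DecidableEq D]

/-- The operator that exchanges two registers with basis `D`. -/
def swapMatrix (D : Type) [DecidableEq D] : Matrix (D × D) (D × D) ℂ :=
  fun p q => if p = q.swap then 1 else 0

/-- The two elements of the swap test: the projections onto the symmetric subspace (outcome
`true`) and onto the antisymmetric subspace (outcome `false`). -/
noncomputable def swapTest (D : Type) [DecidableEq D] (c : Bool) : Matrix (D × D) (D × D) ℂ :=
  (1 / 2 : ℂ) • (1 + (if c then (1 : ℂ) else -1) • swapMatrix D)

theorem conjTranspose_swapMatrix : (swapMatrix D)ᴴ = swapMatrix D := by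
  ext p q
  have : q = p.swap ↔ p = q.swap := ⟨fun h => by simp [h], fun h => by simp [h]⟩
  simp [swapMatrix, this, apply_ite]

theorem sum_swapTest : ∑ c, swapTest D c = 1 := by
  simp only [Fintype.sum_bool, swapTest, if_true, Bool.false_eq_true, if_false]
  module

variable [Fintype D]

theorem swapMatrix_mul (M : Matrix (D × D) (D × D) ℂ) :
    swapMatrix D * M = M.submatrix Prod.swap id := by
  ext p q
  rw [mul_apply, Finset.sum_eq_single p.swap]
  · simp [swapMatrix]
  · intro x _ hx
    have : p ≠ x.swap := fun h => hx (by simp [h])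
    simp [swapMatrix, this]
  · simp

theorem swapMatrix_mul_self : swapMatrix D * swapMatrix D = 1 := by
  rw [swapMatrix_mul]
  ext p q
  simp [swapMatrix, one_apply, Prod.swap_inj]

theorem posSemidef_swapTest (c : Bool) : (swapTest D c).PosSemidef := by
  apply posSemidef_of_projection
  · cases c <;> simp [swapTest, conjTranspose_swapMatrix]
  · cases c <;>
    · simp only [swapTest, mul_add, add_mul, smul_mul_assoc, mul_smul_comm, mul_one, one_mul,
        swapMatrix_mul_self, if_true, smul_smul, smul_add, Bool.false_eq_true, if_false]
      module

/-- The density matrix of the pure state with real amplitudes `a`. -/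
noncomputable def realPure {α : Type} (a : α → ℝ) : Matrix α α ℂ := fun i j => (a i : ℂ) * a j

theorem posSemidef_realPure {α : Type} [Fintype α] (a : α → ℝ) : (realPure a).PosSemidef := by
  have : realPure a = vecMulVec (fun i => (a i : ℂ)) (star fun i => (a i : ℂ)) := by
    ext i j; simp [realPure, vecMulVec_apply]
  rw [this]
  exact posSemidef_vecMulVec_self_star _

theorem trace_realPure {α : Type} [Fintype α] {a : α → ℝ} (ha : ∑ i, a i ^ 2 = 1) :
    (realPure a).trace = 1 := by
  rw [← Complex.ofReal_one, ← ha]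
  simp [trace, realPure, sq]

/-- The swap test on two pure states reveals the square of their inner product. -/
theorem trace_swapTest_mul {a b : D → ℝ} (ha : ∑ i, a i ^ 2 = 1) (hb : ∑ i, b i ^ 2 = 1)
    (c : Bool) : (swapTest D c * kronecker (realPure a) (realPure b)).trace =
      ((if c then (1 + (∑ i, a i * b i) ^ 2) / 2 else (1 - (∑ i, a i * b i) ^ 2) / 2 : ℝ) : ℂ) := by
  have h1 : (kronecker (realPure a) (realPure b)).trace = 1 := by
    have := trace_kronecker (realPure a) (realPure b)
    rw [trace_realPure ha, trace_realPure hb, one_mul] at this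
    exact this
  have h2 : (swapMatrix D * kronecker (realPure a) (realPure b)).trace =
      (((∑ i, a i * b i) ^ 2 : ℝ) : ℂ) := by
    rw [swapMatrix_mul]
    simp only [trace, diag, submatrix_apply, id, kronecker, kroneckerMap_apply, realPure,
      Fintype.sum_prod_type, Prod.fst_swap, Prod.snd_swap]
    rw [sq, Finset.sum_mul_sum]
    push_cast
    exact Finset.sum_congr rfl fun i _ => Finset.sum_congr rfl fun j _ => by ring
  rw [swapTest, smul_mul_assoc, add_mul, one_mul, smul_mul_assoc, trace_smul, trace_add,
    trace_smul, h1, h2]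
  cases c <;> simp <;> ring

end SwapTest

/-! ### Independent repetitions -/

/-- The weight of `s` under `r` independent coin tosses with success probability `p`. -/
noncomputable def coinWeight {r : ℕ} (p : ℝ) (s : Bits r) : ℝ := ∏ i, if s i then p else 1 - p

theorem coinWeight_nonneg {r : ℕ} {p : ℝ} (h0 : 0 ≤ p) (h1 : p ≤ 1) (s : Bits r) :
    0 ≤ coinWeight p s :=
  Finset.prod_nonneg fun i _ => by split_ifs <;> linarith

theorem sum_coinWeight {r : ℕ} (p : ℝ) : ∑ s : Bits r, coinWeight p s = 1 := by
  have := Finset.prod_univ_sum (fun _ : Fin r => (Finset.univ : Finset Bool))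
    (fun _ c => if c then p else 1 - p)
  rw [Fintype.piFinset_univ] at this
  simp only [coinWeight]
  rw [← this]
  simp

theorem sum_coinWeight_variance {r : ℕ} (p : ℝ) :
    ∑ s : Bits r, coinWeight p s * (∑ i, ((if s i then 1 else 0) - p)) ^ 2 = r * (p * (1 - p)) := by
  have key : ∀ i j : Fin r, ∑ s : Bits r, coinWeight p s *
      (((if s i then 1 else 0) - p) * ((if s j then 1 else 0) - p)) =
        if i = j then p * (1 - p) else 0 := by
    intro i j
    have h := Finset.prod_univ_sum (fun _ : Fin r => (Finset.univ : Finset Bool))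
      (fun l c => (if c then p else 1 - p) * ((if l = i then ((if c then 1 else 0) - p) else 1) *
        (if l = j then ((if c then 1 else 0) - p) else 1)))
    rw [Fintype.piFinset_univ] at h
    rw [show ∑ s : Bits r, coinWeight p s *
      (((if s i then 1 else 0) - p) * ((if s j then 1 else 0) - p)) = _ from
        Eq.trans (Finset.sum_congr rfl fun s _ => ?_) h.symm]
    rotate_left
    · rw [Finset.prod_mul_distrib, Finset.prod_mul_distrib, Finset.prod_ite_eq' Finset.univ i,
        Finset.prod_ite_eq' Finset.univ j]
      simp [coinWeight]
    split_ifs with hij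
    · subst hij
      rw [Finset.prod_eq_single i]
      · simp; ring
      · intro l _ hl
        simp [hl]
      · simp
    · apply Finset.prod_eq_zero (Finset.mem_univ i)
      simp [hij]; ring
  calc _ = ∑ s : Bits r, ∑ i, ∑ j, coinWeight p s *
        (((if s i then 1 else 0) - p) * ((if s j then 1 else 0) - p)) := by
        refine Finset.sum_congr rfl fun s _ => ?_
        rw [sq, Finset.sum_mul_sum, Finset.mul_sum]
        simp only [Finset.mul_sum]
    _ = ∑ i : Fin r, ∑ j : Fin r, if i = j then p * (1 - p) else 0 := by
        rw [Finset.sum_comm]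
        refine Finset.sum_congr rfl fun i _ => ?_
        rw [Finset.sum_comm]
        exact Finset.sum_congr rfl fun j _ => key i j
    _ = _ := by simp

/-- Chebyshev's inequality for the number of successes in `r` independent coin tosses. -/
theorem sum_coinWeight_deviation_le {r : ℕ} {p ε : ℝ} (h0 : 0 ≤ p) (h1 : p ≤ 1) (hε : 0 < ε)
    (hr : 3 ≤ 4 * (r * ε ^ 2)) (T : Finset (Bits r))
    (hT : ∀ s ∈ T, r * ε ≤ |∑ i, (((if s i then 1 else 0) : ℝ) - p)|) :
    ∑ s ∈ T, coinWeight p s ≤ 1 / 3 := by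
  have hr0 : (0 : ℝ) < r := by
    rcases Nat.eq_zero_or_pos r with h | h
    · subst h; norm_num at hr
    · exact_mod_cast h
  have hA : 0 < r * ε := mul_pos hr0 hε
  have h : (∑ s ∈ T, coinWeight p s) * (r * ε) ^ 2 ≤ r * (p * (1 - p)) := by
    rw [← sum_coinWeight_variance p, Finset.sum_mul]
    refine (Finset.sum_le_sum fun s hs => ?_).trans
      (Finset.sum_le_univ_sum_of_nonneg fun s => ?_)
    · refine mul_le_mul_of_nonneg_left ?_ (coinWeight_nonneg h0 h1 s)
      rw [← sq_abs (∑ i, _)]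
      exact pow_le_pow_left₀ hA.le (hT s hs) 2
    · exact mul_nonneg (coinWeight_nonneg h0 h1 s) (sq_nonneg _)
  have hp : p * (1 - p) ≤ 1 / 4 := by nlinarith [sq_nonneg (p - 1 / 2)]
  have h2 : (∑ s ∈ T, coinWeight p s) * (r * ε ^ 2) ≤ 1 / 4 := by
    have : (∑ s ∈ T, coinWeight p s) * (r * ε ^ 2) * r ≤ 1 / 4 * r := by nlinarith
    exact le_of_mul_le_mul_right this hr0
  have h3 : 0 ≤ ∑ s ∈ T, coinWeight p s :=
    Finset.sum_nonneg fun s _ => coinWeight_nonneg h0 h1 s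
  nlinarith

/-! ### Estimating inner products in the SMP model -/

/-- A string of `r * d` bits, read as `r` blocks of `d` bits. -/
def bitsBlocks (r d : ℕ) : Bits (r * d) ≃ (Fin r → Bits d) :=
  (Equiv.arrowCongr finProdFinEquiv.symm (Equiv.refl Bool)).trans (Equiv.curry _ _ _)

/-- Pairs of strings, read as `r` pairs of blocks. -/
def pairBlocks (r d : ℕ) : Bits (r * d) × Bits (r * d) ≃ (Fin r → Bits d × Bits d) :=
  (Equiv.prodCongr (bitsBlocks r d) (bitsBlocks r d)).trans
    (Equiv.arrowProdEquivProdArrow _ _ _).symm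

theorem isDensity_copies {r d : ℕ} {a : Bits d → ℝ} (ha : ∑ i, a i ^ 2 = 1) :
    IsDensity ((piKronecker fun _ : Fin r => realPure a).submatrix (bitsBlocks r d)
      (bitsBlocks r d)) := by
  refine ⟨(posSemidef_piKronecker fun _ => posSemidef_realPure a).submatrix _, ?_⟩
  simp only [trace, diag, submatrix_apply]
  rw [Equiv.sum_comp (bitsBlocks r d) fun f => piKronecker (fun _ : Fin r => realPure a) f f]
  have := trace_piKronecker fun _ : Fin r => realPure a
  rw [trace_realPure ha, Finset.prod_const_one] at this
  exact this

/-- The measurement that makes `r` swap tests and accepts if the outcomes form a string in `T`. -/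
noncomputable def swapTests (d r : ℕ) (T : Finset (Bits r)) :
    Matrix (Fin r → Bits d × Bits d) (Fin r → Bits d × Bits d) ℂ :=
  ∑ s ∈ T, piKronecker fun i => swapTest (Bits d) (s i)

theorem isEffect_swapTests (d r : ℕ) (T : Finset (Bits r)) : IsEffect (swapTests d r T) := by
  have h : ∀ T : Finset (Bits r), (swapTests d r T).PosSemidef := fun T =>
    posSemidef_sum _ fun s _ => posSemidef_piKronecker fun i => posSemidef_swapTest _
  refine ⟨h T, ?_⟩
  have : 1 - swapTests d r T = swapTests d r Tᶜ := by
    rw [sub_eq_iff_eq_add', swapTests, swapTests, Finset.sum_add_sum_compl, sum_piKronecker,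
      sum_swapTest, piKronecker_one]
  rw [this]
  exact h _

/-- If `f` is decided by the inner product of a unit vector of Alice's and one of Bob's, in
dimension at most `2 ^ d`, then the parties can send `r` copies of these vectors to the referee, who
makes `r` swap tests and counts the symmetric outcomes. -/
theorem qPar_le_of_inner_gap {X Y ι : Type} [Fintype ι] (f : PromiseProblem X Y) {d : ℕ}
    (hd : Fintype.card ι ≤ 2 ^ d) (a : X → ι → ℝ) (b : Y → ι → ℝ)
    (ha : ∀ x, ∑ i, a x i ^ 2 = 1) (hb : ∀ y, ∑ i, b y i ^ 2 = 1) {lo hi : ℝ} (hlh : lo < hi)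
    (htrue : ∀ x y, f x y true → (∑ i, a x i * b y i) ^ 2 ≤ lo)
    (hfalse : ∀ x y, f x y false → hi ≤ (∑ i, a x i * b y i) ^ 2)
    {r : ℕ} (hr : 12 ≤ r * (hi - lo) ^ 2) :
    QPar f ≤ ((r * d + r * d : ℕ) : ℕ∞) := by
  classical
  obtain ⟨g⟩ : Nonempty (ι ↪ Bits d) := by
    apply Function.Embedding.nonempty_of_card_le
    simpa using hd
  have hsum : ∀ u v : ι → ℝ, ∑ s, Function.extend g u 0 s * Function.extend g v 0 s =
      ∑ i, u i * v i := by
    intro u v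
    rw [← Finset.sum_subset (Finset.subset_univ (Finset.univ.map g)), Finset.sum_map]
    · simp [g.injective.extend_apply]
    · intro s _ hs
      rw [Function.extend_apply']
      · simp
      · rintro ⟨i, rfl⟩; simp at hs
  have ha' : ∀ x, ∑ s, Function.extend g (a x) 0 s ^ 2 = 1 := fun x => by
    simp only [sq] at ha ⊢; rw [hsum, ha]
  have hb' : ∀ x, ∑ s, Function.extend g (b x) 0 s ^ 2 = 1 := fun x => by
    simp only [sq] at hb ⊢; rw [hsum, hb]
  -- the referee accepts if the number of symmetric outcomes is below its expectation for a squared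
  -- inner product in the middle of the gap
  let T : Finset (Bits r) := Finset.univ.filter fun s =>
    (∑ i, if s i then (1 : ℝ) else 0) < r * ((1 + (lo + hi) / 2) / 2)
  let P : QSMPProtocol X Y (r * d) (r * d) :=
    { alice := fun x =>
        (piKronecker fun _ : Fin r => realPure (Function.extend g (a x) 0)).submatrix
        (bitsBlocks r d) (bitsBlocks r d)
      bob := fun y =>
        (piKronecker fun _ : Fin r => realPure (Function.extend g (b y) 0)).submatrix
        (bitsBlocks r d) (bitsBlocks r d)
      referee := (swapTests d r T).submatrix (pairBlocks r d) (pairBlocks r d)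
      alice_density := fun x => isDensity_copies (ha' x)
      bob_density := fun y => isDensity_copies (hb' y)
      referee_effect := ⟨(isEffect_swapTests d r T).1.submatrix _, by
        have := (isEffect_swapTests d r T).2.submatrix (pairBlocks r d)
        simpa [submatrix_sub, submatrix_one_equiv] using this⟩ }
  have hP : ∀ x y, P.acceptProb x y =
      ∑ s ∈ T, coinWeight ((1 + (∑ i, a x i * b y i) ^ 2) / 2) s := by
    intro x y
    have hk : kronecker (P.alice x) (P.bob y) = (piKronecker fun _ : Fin r =>
        kronecker (realPure (Function.extend g (a x) 0))
          (realPure (Function.extend g (b y) 0))).submatrix (pairBlocks r d) (pairBlocks r d) := by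
      ext u v
      simp [P, kronecker, piKronecker, ← Finset.prod_mul_distrib, pairBlocks,
        Equiv.arrowProdEquivProdArrow]
    rw [QSMPProtocol.acceptProb, hk, submatrix_mul_equiv]
    have htr : ∀ M : Matrix (Fin r → Bits d × Bits d) (Fin r → Bits d × Bits d) ℂ,
        (M.submatrix (pairBlocks r d) (pairBlocks r d)).trace = M.trace := fun M =>
      Equiv.sum_comp (pairBlocks r d) fun f => M f f
    rw [htr, swapTests, Finset.sum_mul, trace_sum, Complex.re_sum]
    refine Finset.sum_congr rfl fun s _ => ?_
    rw [piKronecker_mul, trace_piKronecker, coinWeight]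
    simp only [trace_swapTest_mul (ha' x) (hb' y), hsum]
    rw [← Complex.ofReal_prod, Complex.ofReal_re]
    refine Finset.prod_congr rfl fun i _ => ?_
    split_ifs <;> ring
  have hq : ∀ x y, 0 ≤ (∑ i, a x i * b y i) ^ 2 ∧ (∑ i, a x i * b y i) ^ 2 ≤ 1 := fun x y =>
    ⟨sq_nonneg _, by
      simpa [ha, hb] using Finset.sum_mul_sq_le_sq_mul_sq Finset.univ (a x) (b y)⟩
  have hγ : 0 < (hi - lo) / 4 := by linarith
  have hr' : 3 ≤ 4 * (r * ((hi - lo) / 4) ^ 2) := by nlinarith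
  refine sInf_le ⟨r * d, r * d, P, fun x y => ⟨fun h => ?_, fun h => ?_⟩, rfl⟩
  · have hle := htrue x y h
    obtain ⟨q0, q1⟩ := hq x y
    rw [hP]
    set p := (1 + (∑ i, a x i * b y i) ^ 2) / 2
    have h3 := sum_coinWeight_deviation_le (p := p) (by simp only [p]; linarith)
      (by simp only [p]; linarith) hγ hr' Tᶜ (fun s hs => by
        refine le_trans ?_ (le_abs_self _)
        simp only [T, Finset.mem_compl, Finset.mem_filter, Finset.mem_univ, true_and, not_lt] at hs
        rw [Finset.sum_sub_distrib]
        simp only [Finset.sum_const, Finset.card_univ, Fintype.card_fin, nsmul_eq_mul]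
        have : (r : ℝ) * p ≤ r * ((1 + lo) / 2) :=
          mul_le_mul_of_nonneg_left (by simp only [p]; linarith) (Nat.cast_nonneg r)
        nlinarith)
    have h4 := Finset.sum_add_sum_compl T (coinWeight p)
    rw [sum_coinWeight] at h4
    linarith
  · have hle := hfalse x y h
    obtain ⟨q0, q1⟩ := hq x y
    rw [hP]
    set p := (1 + (∑ i, a x i * b y i) ^ 2) / 2
    refine sum_coinWeight_deviation_le (p := p) (by simp only [p]; linarith)
      (by simp only [p]; linarith) hγ hr' T (fun s hs => ?_)
    refine le_trans ?_ (neg_le_abs _)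
    simp only [T, Finset.mem_filter, Finset.mem_univ, true_and] at hs
    rw [Finset.sum_sub_distrib]
    simp only [Finset.sum_const, Finset.card_univ, Fintype.card_fin, nsmul_eq_mul]
    have : (r : ℝ) * ((1 + hi) / 2) ≤ r * p :=
      mul_le_mul_of_nonneg_left (by simp only [p]; linarith) (Nat.cast_nonneg r)
    nlinarith

/-! ### Four-round protocols -/

/-- The preparation of a state with amplitudes `u z` next to a classical register `κ` with contents
`z`; the factor `ε` of the old register is a trivial one in all uses. -/
def preparation {κ γ ε : Type} [DecidableEq κ] (u : κ → γ → ℂ) : Matrix (κ × γ) (ε × κ) ℂ :=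
  fun p q => if p.1 = q.2 then u q.2 p.2 else 0

theorem preparation_isometry {κ γ : Type} [Fintype κ] [DecidableEq κ] [Fintype γ]
    {u : κ → γ → ℂ} (hu : ∀ z, star (u z) ⬝ᵥ u z = 1) :
    (preparation u : Matrix (κ × γ) (Unit × κ) ℂ)ᴴ *
      (preparation u : Matrix (κ × γ) (Unit × κ) ℂ) = 1 := by
  ext ⟨⟨⟩, z⟩ ⟨⟨⟩, z'⟩
  simp only [mul_apply, conjTranspose_apply, preparation, Fintype.sum_prod_type, apply_ite star,
    star_zero, ite_mul, zero_mul, mul_ite, mul_zero]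
  rw [Finset.sum_eq_single z]
  · by_cases h : z = z'
    · subst h
      simpa [dotProduct] using hu z
    · simp [h]
  · intro p _ hp
    simp [hp]
  · simp

/-- The unitaries `W z`, controlled by a classical register with contents `z`. -/
def controlled {κ γ : Type} [DecidableEq κ] (W : κ → Matrix γ γ ℂ) : Matrix (κ × γ) (κ × γ) ℂ :=
  (blockDiagonal W).submatrix Prod.swap Prod.swap

theorem controlled_apply {κ γ : Type} [DecidableEq κ] (W : κ → Matrix γ γ ℂ) (p q : κ × γ) :
    controlled W p q = if p.1 = q.1 then W p.1 p.2 q.2 else 0 := rfl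

theorem conjTranspose_controlled {κ γ : Type} [DecidableEq κ] (W : κ → Matrix γ γ ℂ) :
    (controlled W)ᴴ = controlled fun z => (W z)ᴴ := by
  rw [controlled, conjTranspose_submatrix, blockDiagonal_conjTranspose]; rfl

theorem controlled_mul {κ γ : Type} [Fintype κ] [DecidableEq κ] [Fintype γ]
    (W W' : κ → Matrix γ γ ℂ) :
    controlled W * controlled W' = controlled fun z => W z * W' z := by
  rw [controlled, controlled, controlled, blockDiagonal_mul]
  exact submatrix_mul_equiv (blockDiagonal W) (blockDiagonal W') Prod.swap (Equiv.prodComm _ _) _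

theorem controlled_one {κ γ : Type} [DecidableEq κ] [DecidableEq γ] :
    controlled (fun _ : κ => (1 : Matrix γ γ ℂ)) = 1 := by
  have : (fun _ : κ => (1 : Matrix γ γ ℂ)) = 1 := rfl
  rw [controlled, this, blockDiagonal_one]
  exact submatrix_one_equiv (Equiv.prodComm κ γ)

theorem sum_controlled_mul {κ ν γ : Type} [Fintype κ] [DecidableEq κ] [DecidableEq ν] [Fintype γ]
    (W : κ → Matrix γ γ ℂ) (ψ : γ → ℂ) (z₀ : κ) (l₀ : ν) (p : κ × γ) (l : ν) :
    ∑ a : κ × γ, controlled W p a * (if a.1 = z₀ ∧ l = l₀ then ψ a.2 else 0) =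
      if p.1 = z₀ ∧ l = l₀ then (W z₀ *ᵥ ψ) p.2 else 0 := by
  simp only [Fintype.sum_prod_type, controlled_apply]
  rw [Finset.sum_eq_single p.1]
  · by_cases h : p.1 = z₀
    · by_cases h' : l = l₀ <;> simp [h, h', mulVec, dotProduct]
    · simp [h]
  · intro z _ hz
    simp [hz.symm]
  · simp

theorem trace_controlled {κ ν γ : Type} [Fintype κ] [DecidableEq κ] [Fintype ν] [DecidableEq ν]
    [Fintype γ] (P : κ → Matrix γ γ ℂ) (ψ : γ → ℂ) (z₀ : κ) (l₀ : ν) (Ψ : Matrix (κ × γ) ν ℂ)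
    (hΨ : ∀ p l, Ψ p l = if p.1 = z₀ ∧ l = l₀ then ψ p.2 else 0) :
    (Ψᴴ * controlled P * Ψ).trace = star ψ ⬝ᵥ (P z₀ *ᵥ ψ) := by
  have h : ∀ p l, (controlled P * Ψ) p l =
      if p.1 = z₀ ∧ l = l₀ then (P z₀ *ᵥ ψ) p.2 else 0 := by
    intro p l
    rw [mul_apply, ← sum_controlled_mul]
    simp only [hΨ]
  rw [Matrix.mul_assoc]
  change ∑ l, ∑ p, star (Ψ p l) * (controlled P * Ψ) p l = _
  simp only [h, hΨ, apply_ite star, star_zero]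
  rw [Finset.sum_eq_single l₀, Fintype.sum_prod_type, Finset.sum_eq_single z₀]
  · simp [dotProduct]
  · intro z _ hz
    simp [hz]
  · simp
  · intro z _ hz
    simp [hz]
  · simp

/-- Alice sends the classical string `X x`, Bob keeps it and answers with the classical string
`Y y`, Alice keeps that, prepares the quantum state `u x (Y y)` and sends it, Bob applies the
unitary `W y (X x)` to it and sends it back, and Alice accepts if a measurement finds it in the range of the
projection `P x (Y y)`. -/
noncomputable def fourRoundProtocol {A B : Type} {t q : ℕ} (X : A → Bits t) (Y : B → Bits t)
    (u : A → Bits t → Bits q → ℂ) (hu : ∀ x z, star (u x z) ⬝ᵥ u x z = 1)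
    (W : B → Bits t → Matrix (Bits q) (Bits q) ℂ) (hW : ∀ y z, (W y z)ᴴ * W y z = 1)
    (P : A → Bits t → Matrix (Bits q) (Bits q) ℂ) (hP1 : ∀ x z, (P x z)ᴴ = P x z)
    (hP2 : ∀ x z, P x z * P x z = P x z) : QProtocol A B Unit Unit :=
  .send Unit t (fun x => Matrix.of fun p _ => if p.2 = X x then 1 else 0)
    (fun x => by
      ext ⟨⟩ ⟨⟩
      rw [mul_apply]
      simp only [conjTranspose_apply, Fintype.sum_prod_type, of_apply, apply_ite star]
      simp)
  (.send (Bits t) t (fun y => preparation fun _ s => if s = Y y then 1 else 0)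
    (fun y => preparation_isometry fun z => by
      simp [dotProduct, apply_ite star])
  (.send (Bits t) q (fun x => preparation (u x)) (fun x => preparation_isometry (hu x))
  (.send (Bits t) q (fun y => controlled (W y))
    (fun y => by
      rw [conjTranspose_controlled, controlled_mul]
      simp only [hW, controlled_one])
  (.output (fun x => controlled (P x)) fun x => isEffect_of_projection
    (by rw [conjTranspose_controlled]; simp only [hP1])
    (by rw [controlled_mul]; simp only [hP2])))))

section FourRound

variable {A B : Type} {t q : ℕ} (X : A → Bits t) (Y : B → Bits t)
    (u : A → Bits t → Bits q → ℂ) (hu : ∀ x z, star (u x z) ⬝ᵥ u x z = 1)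
    (W : B → Bits t → Matrix (Bits q) (Bits q) ℂ) (hW : ∀ y z, (W y z)ᴴ * W y z = 1)
    (P : A → Bits t → Matrix (Bits q) (Bits q) ℂ) (hP1 : ∀ x z, (P x z)ᴴ = P x z)
    (hP2 : ∀ x z, P x z * P x z = P x z)

theorem acceptProb_fourRoundProtocol (x : A) (y : B) :
    (fourRoundProtocol X Y u hu W hW P hP1 hP2).acceptProb x y (fun _ _ => 1) =
      (star (W y (X x) *ᵥ u x (Y y)) ⬝ᵥ (P x (Y y) *ᵥ (W y (X x) *ᵥ u x (Y y)))).re := by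
  have h1 : ∀ (p : Unit × Bits t) (a' : Bits t),
      ∑ a : Unit × Bits t, (preparation (fun _ s => if s = Y y then 1 else 0) :
        Matrix (Bits t × Bits t) (Unit × Bits t) ℂ) (a', p.2) a *
        (∑ _x : Unit, (if a.2 = X x then (1 : ℂ) else 0) * 1) =
        if a' = X x ∧ p.2 = Y y then 1 else 0 := by
    intro p a'
    simp only [Fintype.sum_prod_type, preparation]
    simp [ite_and]
  have h2 : ∀ (p : Bits t × Bits q) (a' : Bits t),
      ∑ a : Unit × Bits t, (preparation (u x) : Matrix (Bits t × Bits q) (Unit × Bits t) ℂ)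
        (a', p.2) a * (if p.1 = X x ∧ a.2 = Y y then 1 else 0) =
        if p.1 = X x ∧ a' = Y y then u x (Y y) p.2 else 0 := by
    intro p a'
    simp only [Fintype.sum_prod_type, preparation]
    by_cases h : p.1 = X x <;> simp [h]
  have h3 : ∀ (p : Bits t × Bits q) (a' : Bits t),
      ∑ a : Bits t × Bits q, controlled (W y) (a', p.2) a *
        (if a.1 = X x ∧ p.1 = Y y then u x (Y y) a.2 else 0) =
        if p.1 = Y y ∧ a' = X x then (W y (X x) *ᵥ u x (Y y)) p.2 else 0 := by
    intro p a'
    rw [sum_controlled_mul]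
    simp only [and_comm]
  simp only [fourRoundProtocol, QProtocol.acceptProb, of_apply, h1, h2, h3]
  rw [trace_controlled (P x) (W y (X x) *ᵥ u x (Y y)) (Y y) (X x) _ fun _ _ => rfl]

end FourRound

/-! ### Stability of the overlap under rounding -/

/-- The Euclidean norm of a coordinate vector. -/
noncomputable def l2norm {ι : Type} [Fintype ι] (v : ι → ℝ) : ℝ := ‖WithLp.toLp 2 v‖

section Norm

variable {ι κ : Type} [Fintype ι] [Fintype κ]

theorem l2norm_sq (v : ι → ℝ) : l2norm v ^ 2 = ∑ i, v i ^ 2 := by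
  rw [l2norm, EuclideanSpace.real_norm_sq_eq]

theorem l2norm_nonneg (v : ι → ℝ) : 0 ≤ l2norm v := norm_nonneg _

theorem l2norm_add_le (v w : ι → ℝ) : l2norm (v + w) ≤ l2norm v + l2norm w := by
  rw [l2norm, WithLp.toLp_add]
  exact norm_add_le _ _

theorem l2norm_sq_eq_dotProduct (v : ι → ℝ) : l2norm v ^ 2 = v ⬝ᵥ v := by
  rw [l2norm_sq]
  simp [dotProduct, sq]

theorem l2norm_le_of_entries {v : ι → ℝ} {ε : ℝ} (hε : 0 ≤ ε) {n : ℕ} (hι : Fintype.card ι ≤ n)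
    (h : ∀ i, |v i| ≤ ε) : l2norm v ≤ n * ε := by
  refine le_of_abs_le (abs_le_of_sq_le_sq ?_ (by positivity))
  rw [l2norm_sq]
  have h1 : ∑ i, v i ^ 2 ≤ ∑ _i : ι, ε ^ 2 := Finset.sum_le_sum fun i _ => by
    rw [← sq_abs]; exact pow_le_pow_left₀ (abs_nonneg _) (h i) 2
  rw [Finset.sum_const, Finset.card_univ, nsmul_eq_mul] at h1
  have h2 : (Fintype.card ι : ℝ) ≤ (n : ℝ) ^ 2 := by
    have : n ≤ n ^ 2 := Nat.le_self_pow two_ne_zero n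
    exact_mod_cast hι.trans this
  calc _ ≤ _ := h1
    _ ≤ (n : ℝ) ^ 2 * ε ^ 2 := mul_le_mul_of_nonneg_right h2 (sq_nonneg _)
    _ = _ := by ring

theorem l2norm_mulVec_le_of_entries {M : Matrix ι κ ℝ} {ε : ℝ} (hε : 0 ≤ ε) {n : ℕ}
    (hι : Fintype.card ι ≤ n) (hκ : Fintype.card κ ≤ n) (h : ∀ i j, |M i j| ≤ ε) (x : κ → ℝ) :
    l2norm (M *ᵥ x) ≤ n * ε * l2norm x := by
  refine le_of_abs_le (abs_le_of_sq_le_sq ?_ (by have := l2norm_nonneg x; positivity))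
  rw [l2norm_sq, mul_pow, l2norm_sq]
  have h1 : ∀ i, (M *ᵥ x) i ^ 2 ≤ (n * ε ^ 2) * ∑ j, x j ^ 2 := by
    intro i
    refine (Finset.sum_mul_sq_le_sq_mul_sq Finset.univ (M i) x).trans ?_
    refine mul_le_mul_of_nonneg_right ?_ (Finset.sum_nonneg fun _ _ => sq_nonneg _)
    have h1 : ∑ j, M i j ^ 2 ≤ ∑ _j : κ, ε ^ 2 := Finset.sum_le_sum fun j _ => by
      rw [← sq_abs]; exact pow_le_pow_left₀ (abs_nonneg _) (h i j) 2
    rw [Finset.sum_const, Finset.card_univ, nsmul_eq_mul] at h1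
    exact h1.trans (mul_le_mul_of_nonneg_right (by exact_mod_cast hκ) (sq_nonneg _))
  refine (Finset.sum_le_sum fun i _ => h1 i).trans ?_
  rw [Finset.sum_const, Finset.card_univ, nsmul_eq_mul, mul_pow, sq (n : ℝ), mul_assoc (n : ℝ) n,
    mul_assoc (n : ℝ) (_ * _)]
  refine mul_le_mul_of_nonneg_right (by exact_mod_cast hι) ?_
  exact mul_nonneg (by positivity) (Finset.sum_nonneg fun _ _ => sq_nonneg _)

theorem l2norm_mulVec_of_isometry [DecidableEq κ] {U : Matrix ι κ ℝ} (hU : Uᵀ * U = 1)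
    (x : κ → ℝ) : l2norm (U *ᵥ x) = l2norm x := by
  rw [← sq_eq_sq₀ (l2norm_nonneg _) (l2norm_nonneg _), l2norm_sq_eq_dotProduct,
    l2norm_sq_eq_dotProduct, dotProduct_mulVec, ← mulVec_transpose, mulVec_mulVec, hU, one_mulVec]

/-- Bessel's inequality for the orthonormal rows of `E`. -/
theorem l2norm_mulVec_le_of_coisometry [DecidableEq ι] {E : Matrix ι κ ℝ} (hE : E * Eᵀ = 1)
    (x : κ → ℝ) : l2norm (E *ᵥ x) ≤ l2norm x := by
  refine le_of_abs_le (abs_le_of_sq_le_sq ?_ (l2norm_nonneg _))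
  have h0 := sq_nonneg (l2norm (x - Eᵀ *ᵥ (E *ᵥ x)))
  have h1 : (Eᵀ *ᵥ (E *ᵥ x)) ⬝ᵥ x = (E *ᵥ x) ⬝ᵥ (E *ᵥ x) := by
    rw [mulVec_transpose, ← dotProduct_mulVec]
  have h2 : (Eᵀ *ᵥ (E *ᵥ x)) ⬝ᵥ (Eᵀ *ᵥ (E *ᵥ x)) = (E *ᵥ x) ⬝ᵥ (E *ᵥ x) := by
    rw [mulVec_transpose, ← dotProduct_mulVec, ← mulVec_transpose, mulVec_mulVec, hE, one_mulVec]
  rw [l2norm_sq_eq_dotProduct, sub_dotProduct, dotProduct_sub, dotProduct_sub, h2,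
    dotProduct_comm x (Eᵀ *ᵥ _), h1] at h0
  rw [l2norm_sq_eq_dotProduct, l2norm_sq_eq_dotProduct]
  linarith

end Norm

/-- The length of the projection of `U v` to the span of the rows of `E`, if these are
orthonormal. -/
noncomputable def overlap {m d : ℕ} (E : Matrix (Fin d) (Fin m) ℝ) (U : Matrix (Fin m) (Fin m) ℝ)
    (v : Fin m → ℝ) : ℝ := l2norm (E *ᵥ (U *ᵥ v))

theorem overlap_le_one {m d : ℕ} {E : Matrix (Fin d) (Fin m) ℝ} {U : Matrix (Fin m) (Fin m) ℝ}
    {v : Fin m → ℝ} (hE : E * Eᵀ = 1) (hU : Uᵀ * U = 1) (hv : l2norm v = 1) :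
    overlap E U v ≤ 1 :=
  (l2norm_mulVec_le_of_coisometry hE _).trans (l2norm_mulVec_of_isometry hU v ▸ hv.le)

theorem overlap_le_add {m d : ℕ} {E E' : Matrix (Fin d) (Fin m) ℝ}
    {U U' : Matrix (Fin m) (Fin m) ℝ} {v v' : Fin m → ℝ} (hE : E * Eᵀ = 1) (hU : Uᵀ * U = 1)
    (hU' : U'ᵀ * U' = 1) (hv' : l2norm v' = 1) (hd : d ≤ m) {ε : ℝ} (hε : 0 ≤ ε)
    (hEE : ∀ i j, |E i j - E' i j| ≤ ε) (hUU : ∀ i j, |U i j - U' i j| ≤ ε)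
    (hvv : ∀ i, |v i - v' i| ≤ ε) : overlap E U v ≤ overlap E' U' v' + 3 * (m * ε) := by
  have hsplit : E *ᵥ (U *ᵥ v) = E' *ᵥ (U' *ᵥ v') + ((E - E') *ᵥ (U' *ᵥ v') +
      (E *ᵥ ((U - U') *ᵥ v') + E *ᵥ (U *ᵥ (v - v')))) := by
    simp only [mulVec_sub, sub_mulVec]
    abel
  have h1 : l2norm ((E - E') *ᵥ (U' *ᵥ v')) ≤ m * ε := by
    have := l2norm_mulVec_le_of_entries (M := E - E') hε (by simpa using hd) (by simp) hEE 
      (U' *ᵥ v')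
    rwa [l2norm_mulVec_of_isometry hU', hv', mul_one] at this
  have h2 : l2norm (E *ᵥ ((U - U') *ᵥ v')) ≤ m * ε := by
    refine (l2norm_mulVec_le_of_coisometry hE _).trans ?_
    have := l2norm_mulVec_le_of_entries (M := U - U') (n := m) hε (by simp) (by simp) hUU v'
    rwa [hv', mul_one] at this
  have h3 : l2norm (E *ᵥ (U *ᵥ (v - v'))) ≤ m * ε := by
    refine (l2norm_mulVec_le_of_coisometry hE _).trans ?_
    rw [l2norm_mulVec_of_isometry hU]
    exact l2norm_le_of_entries hε (by simp) hvv
  rw [overlap, hsplit]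
  have h4 := l2norm_add_le (E' *ᵥ (U' *ᵥ v')) ((E - E') *ᵥ (U' *ᵥ v') +
      (E *ᵥ ((U - U') *ᵥ v') + E *ᵥ (U *ᵥ (v - v'))))
  have h5 := l2norm_add_le ((E - E') *ᵥ (U' *ᵥ v')) (E *ᵥ ((U - U') *ᵥ v') + E *ᵥ (U *ᵥ (v - v')))
  have h6 := l2norm_add_le (E *ᵥ ((U - U') *ᵥ v')) (E *ᵥ (U *ᵥ (v - v')))
  rw [overlap]
  linarith

/-! ### Reading the finite inputs -/

section Readings

variable {k m w b : ℕ}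

/-- The unit vectors `v i` and the matrices `E i` with orthonormal rows are exact data that Alice's
finite input `a` describes; the rows of `E i` form a basis of her `i`-th subspace. -/
def AliceInput.IsReading (a : AliceInput k m b) (v : Fin k → Fin m → ℝ)
    (E : Fin k → Matrix (Fin (m / 2)) (Fin m) ℝ) : Prop :=
  ((∀ i, l2norm (v i) = 1) ∧ ∀ i, E i * (E i)ᵀ = 1) ∧
    (∀ i p, Approximates (a.v i p) (v i p)) ∧ ∀ i j p, Approximates (a.S i j p) (E i j p)

/-- The orthogonal matrices `U i` are exact data that Bob's finite input `a` describes. -/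
def BobInput.IsReading (a : BobInput k m b) (U : Fin k → Matrix (Fin m) (Fin m) ℝ) : Prop :=
  (∀ i, (U i)ᵀ * U i = 1) ∧ ∀ i p p', Approximates (a.U i p p') (U i p p')

theorem Approximates.abs_sub_le {s : Bits b} {t t' : ℝ} (h : Approximates s t)
    (h' : Approximates s t') : |t - t'| ≤ 2 / 2 ^ b := by
  have := _root_.abs_sub_le t (fixedPoint s) t'
  rw [abs_sub_comm t (fixedPoint s)] at this
  unfold Approximates at h h'
  calc _ ≤ _ := this
    _ ≤ 1 / 2 ^ b + 1 / 2 ^ b := add_le_add h h'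
    _ = _ := by ring

theorem ManyRaz.exists_reading {a : AliceInput k m b} {a' : BobInput k m b} {ans : Bool}
    (h : ManyRaz k m w b a a' ans) : ∃ v E U, a.IsReading v E ∧ a'.IsReading U ∧
      (Finset.univ.filter fun i => a.x i ≠ a'.y i).card = w ∧
      ∀ i, a.x i ≠ a'.y i → overlap (E i) (U i) (v i) = if ans then 0 else 1 := by
  obtain ⟨A, B, ⟨hx, hv, hS⟩, ⟨hy, hU⟩, hw, hans⟩ := h
  choose e he using hS
  have hO : ∀ i, (B.U i)ᵀ * B.U i = 1 := fun i =>
    (mem_orthogonalGroup_iff' _ _).mp (B.U_orthogonal i)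
  have hn : ∀ i, l2norm (A.v i) = 1 := fun i => A.norm_v i
  refine ⟨fun i => A.v i, fun i => Matrix.of fun j p => (e i j : EuclideanSpace ℝ (Fin m)) p, B.U,
    ⟨⟨hn, fun i => ?_⟩, hv, he⟩, ⟨hO, hU⟩, by rw [hx, hy]; exact hw, fun i hi => ?_⟩
  · ext j l
    have := (orthonormal_iff_ite.mp (e i).orthonormal) l j
    rw [Submodule.coe_inner, PiLp.inner_apply] at this
    simpa [mul_apply, one_apply, eq_comm] using this
  · rw [hx, hy] at hi
    have hmem := hans i hi
    set u := Matrix.toEuclideanLin (B.U i) (A.v i) with hu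
    have hunorm : ‖u‖ = 1 := (l2norm_mulVec_of_isometry (hO i) (A.v i)).trans (hn i)
    have hsq : overlap (Matrix.of fun j p => (e i j : EuclideanSpace ℝ (Fin m)) p) (B.U i)
        (A.v i) ^ 2 = ∑ j, inner ℝ (e i j : EuclideanSpace ℝ (Fin m)) u ^ 2 := by
      rw [overlap, l2norm_sq]
      refine Finset.sum_congr rfl fun j _ => ?_
      congr 1
      rw [PiLp.inner_apply]
      simp only [mulVec, dotProduct, of_apply, RCLike.inner_apply, conj_trivial]
      exact Finset.sum_congr rfl fun p _ => mul_comm _ _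
    cases ans with
    | true =>
      simp only [if_true] at hmem ⊢
      rw [← sq_eq_zero_iff, hsq]
      refine Finset.sum_eq_zero fun j _ => ?_
      rw [(Submodule.mem_orthogonal _ _).mp hmem _ (e i j).2]
      norm_num
    | false =>
      simp only [Bool.false_eq_true, if_false] at hmem ⊢
      refine (sq_eq_sq₀ (l2norm_nonneg _) zero_le_one).mp (Eq.trans hsq ?_)
      have := (e i).sum_sq_norm_inner_right ⟨u, hmem⟩
      simp only [Submodule.coe_inner, Real.norm_eq_abs, sq_abs, Submodule.coe_norm, hunorm] at this
      exact this

/-- The parties can replace their finite inputs by exact ones, and whenever the promise holds the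
overlaps at the positions where the strings differ reveal the answer. -/
theorem exists_readings (k w : ℕ) (hm : 72 ≤ m) (hb : m ^ 2 ≤ 2 ^ b) :
    ∃ (v : AliceInput k m b → Fin k → Fin m → ℝ)
      (E : AliceInput k m b → Fin k → Matrix (Fin (m / 2)) (Fin m) ℝ)
      (U : BobInput k m b → Fin k → Matrix (Fin m) (Fin m) ℝ),
      (∀ a i, l2norm (v a i) = 1) ∧ (∀ a i, E a i * (E a i)ᵀ = 1) ∧
      (∀ a i, (U a i)ᵀ * U a i = 1) ∧
      ∀ a a' ans, ManyRaz k m w b a a' ans →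
        (Finset.univ.filter fun i => a.x i ≠ a'.y i).card = w ∧
        ∀ i, a.x i ≠ a'.y i → if ans then overlap (E a i) (U a' i) (v a i) ≤ 1 / 12
          else 11 / 12 ≤ overlap (E a i) (U a' i) (v a i) := by
  have hA : ∀ a : AliceInput k m b, ∃ v E, ((∀ i, l2norm (v i) = 1) ∧
      ∀ i, (E i : Matrix (Fin (m / 2)) (Fin m) ℝ) * (E i)ᵀ = 1) ∧
      ∀ v' E', a.IsReading v' E' → a.IsReading v E := by
    intro a
    by_cases h : ∃ v E, a.IsReading v E
    · obtain ⟨v, E, h⟩ := h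
      exact ⟨v, E, h.1, fun _ _ _ => h⟩
    · -- without a reading the input is outside the promise, and any data of the right kind will do
      refine ⟨fun _ => Pi.single ⟨0, by omega⟩ 1,
        fun _ => (1 : Matrix (Fin m) (Fin m) ℝ).submatrix (Fin.castLE (Nat.div_le_self m 2)) id,
        ⟨fun i => ?_, fun i => ?_⟩, fun v' E' h' => absurd ⟨v', E', h'⟩ h⟩
      · rw [← sq_eq_sq₀ (l2norm_nonneg _) zero_le_one, l2norm_sq_eq_dotProduct]
        simp
      · ext j l
        simp [mul_apply, one_apply, Fin.castLE_inj, eq_comm]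
  have hB : ∀ a : BobInput k m b, ∃ U, (∀ i, (U i)ᵀ * U i = 1) ∧
      ∀ U', a.IsReading U' → a.IsReading U := by
    intro a
    by_cases h : ∃ U, a.IsReading U
    · obtain ⟨U, h⟩ := h
      exact ⟨U, h.1, fun _ _ => h⟩
    · exact ⟨fun _ => 1, fun i => by simp, fun U' h' => absurd ⟨U', h'⟩ h⟩
  choose v E hvE hread using hA
  choose U hU hreadU using hB
  refine ⟨v, E, U, fun a => (hvE a).1, fun a => (hvE a).2, hU, fun a a' ans h => ?_⟩
  obtain ⟨v', E', U', hr, hr', hw, hans⟩ := h.exists_reading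
  refine ⟨hw, fun i hi => ?_⟩
  have hm0 : (72 : ℝ) ≤ m := by exact_mod_cast hm
  -- the readings differ by at most `2 / 2 ^ b ≤ 2 / m ^ 2` in each entry
  have hε : 3 * ((m : ℝ) * (2 / 2 ^ b)) ≤ 1 / 12 := by
    have : (m : ℝ) ^ 2 ≤ 2 ^ b := by exact_mod_cast hb
    rw [← mul_div_assoc, ← mul_div_assoc, div_le_div_iff₀ (by positivity) (by norm_num)]
    nlinarith
  have hε0 : (0 : ℝ) ≤ 2 / 2 ^ b := by positivity
  have hra := hread a _ _ hr
  have hrb := hreadU a' _ hr'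
  have h1 := overlap_le_add (hra.1.2 i) (hrb.1 i) (hr'.1 i) (hr.1.1 i) (Nat.div_le_self m 2) hε0
    (fun j p => (hra.2.2 i j p).abs_sub_le (hr.2.2 i j p))
    (fun j p => (hrb.2 i j p).abs_sub_le (hr'.2 i j p))
    (fun p => (hra.2.1 i p).abs_sub_le (hr.2.1 i p))
  have h2 := overlap_le_add (hr.1.2 i) (hr'.1 i) (hrb.1 i) (hra.1.1 i) (Nat.div_le_self m 2) hε0
    (fun j p => (hr.2.2 i j p).abs_sub_le (hra.2.2 i j p))
    (fun j p => (hr'.2 i j p).abs_sub_le (hrb.2 i j p))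
    (fun p => (hr.2.1 i p).abs_sub_le (hra.2.1 i p))
  have h3 := hans i hi
  cases ans with
  | true => simp only [if_true] at h3 ⊢; linarith
  | false => simp only [Bool.false_eq_true, if_false] at h3 ⊢; linarith

end Readings

/-! ### Sampling positions with few random bits -/

/-- Second moment of a sum of pairwise independent centred variables, for the pairwise independent
points `α * u j + β` of a finite field. -/
theorem sum_sq_affine {F : Type} [Field F] [Fintype F] {t : ℕ} {u : Fin t → F}
    (hu : Function.Injective u) {φ : F → ℝ} (hφ : ∑ z, φ z = 0) :
    ∑ c : F × F, (∑ j, φ (c.1 * u j + c.2)) ^ 2 = t * (Fintype.card F * ∑ z, φ z ^ 2) := by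
  have key : ∀ j l, ∑ c : F × F, φ (c.1 * u j + c.2) * φ (c.1 * u l + c.2) =
      if j = l then Fintype.card F * ∑ z, φ z ^ 2 else 0 := by
    intro j l
    split_ifs with h
    · subst h
      rw [Fintype.sum_prod_type]
      have : ∀ α : F, ∑ β, φ (α * u j + β) * φ (α * u j + β) = ∑ z, φ z ^ 2 := fun α => by
        rw [← Equiv.sum_comp (Equiv.addLeft (α * u j)) fun z => φ z ^ 2]
        simp [sq]
      simp [this]
    · have hne : u j - u l ≠ 0 := sub_ne_zero.mpr fun h' => h (hu h')
      -- the values at two distinct points determine the line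
      let g : F × F ≃ F × F :=
        { toFun := fun c => (c.1 * u j + c.2, c.1 * u l + c.2)
          invFun := fun z => ((z.1 - z.2) / (u j - u l), z.1 - (z.1 - z.2) / (u j - u l) * u j)
          left_inv := fun c => by
            ext
            · field_simp; ring
            · field_simp; ring
          right_inv := fun z => by
            ext
            · field_simp; ring
            · field_simp; ring }
      have : ∑ c : F × F, φ (c.1 * u j + c.2) * φ (c.1 * u l + c.2) =
          ∑ z : F × F, φ z.1 * φ z.2 := Equiv.sum_comp g fun z => φ z.1 * φ z.2
      rw [this, Fintype.sum_prod_type, ← Finset.sum_mul_sum, hφ, zero_mul]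
  have : ∀ c : F × F, (∑ j, φ (c.1 * u j + c.2)) ^ 2 =
      ∑ j, ∑ l, φ (c.1 * u j + c.2) * φ (c.1 * u l + c.2) := fun c => by
    rw [sq, Finset.sum_mul_sum]
  simp only [this]
  rw [Finset.sum_comm]
  have h2 : ∀ j : Fin t, ∑ c : F × F, ∑ l, φ (c.1 * u j + c.2) * φ (c.1 * u l + c.2) =
      Fintype.card F * ∑ z, φ z ^ 2 := fun j => by
    rw [Finset.sum_comm]
    simp [key]
  simp [h2]

/-- Only a small fraction of the lines `α * u + β` avoid a dense set at all of `t` points. -/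
theorem card_affine_avoiding_le {F : Type} [Field F] [Fintype F] [DecidableEq F] {t : ℕ}
    {u : Fin t → F} (hu : Function.Injective u) (D : Finset F) :
    ((Finset.univ.filter fun c : F × F => ∀ j, c.1 * u j + c.2 ∉ D).card : ℝ) * (t * D.card) ≤
      (Fintype.card F : ℝ) ^ 3 := by
  set N : ℝ := (Fintype.card F : ℝ)
  set d : ℝ := (D.card : ℝ)
  have hN : 0 < N := by simp only [N]; exact_mod_cast Fintype.card_pos
  have hd : 0 ≤ d := Nat.cast_nonneg _
  rcases hd.eq_or_lt with h0 | hd0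
  · rw [← h0]; simp; positivity
  rcases Nat.eq_zero_or_pos t with h0 | ht
  · subst h0; simp; positivity
  have ht' : (0 : ℝ) < t := by exact_mod_cast ht
  -- the centred indicator of `D`, whose sum over the points of an avoiding line is `- t d / N`
  let φ : F → ℝ := fun z => (if z ∈ D then 1 else 0) - d / N
  have hφ : ∑ z, φ z = 0 := by
    simp only [φ, Finset.sum_sub_distrib]
    simp [N, d]
    field_simp
    ring
  have hφ2 : ∑ z, φ z ^ 2 ≤ d := by
    have h : ∀ z, φ z ^ 2 = (if z ∈ D then 1 else 0) - 2 * (d / N) * φ z - (d / N) ^ 2 := by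
      intro z
      simp only [φ]; split_ifs <;> ring
    simp only [h, Finset.sum_sub_distrib, ← Finset.mul_sum, hφ]
    simp [d]
    positivity
  set S := Finset.univ.filter fun c : F × F => ∀ j, c.1 * u j + c.2 ∉ D
  have h1 : (S.card : ℝ) * (t * (d / N)) ^ 2 ≤ t * (N * d) := by
    calc (S.card : ℝ) * (t * (d / N)) ^ 2 = ∑ c ∈ S, (∑ j, φ (c.1 * u j + c.2)) ^ 2 := by
          rw [← nsmul_eq_mul, ← Finset.sum_const]
          refine Finset.sum_congr rfl fun c hc => ?_
          have hc' : ∀ j, c.1 * u j + c.2 ∉ D := (Finset.mem_filter.mp hc).2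
          simp [φ, hc']
      _ ≤ ∑ c : F × F, (∑ j, φ (c.1 * u j + c.2)) ^ 2 :=
          Finset.sum_le_univ_sum_of_nonneg fun c => sq_nonneg _
      _ = t * (N * ∑ z, φ z ^ 2) := sum_sq_affine hu hφ
      _ ≤ _ := by gcongr
  have h2 : (S.card : ℝ) * (t * (d / N)) ^ 2 = (S.card : ℝ) * (t * d) * (t * d) / N ^ 2 := by
    field_simp
  rw [h2, div_le_iff₀ (by positivity)] at h1
  have h3 : (S.card : ℝ) * (t * d) * (t * d) ≤ N ^ 3 * (t * d) := h1.trans_eq (by ring)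
  exact le_of_mul_le_mul_right h3 (by positivity)

/-- With `2 L` random bits one can choose `t` positions among `k ≤ 2 ^ L` so that for every set of
positions of size `d` the probability to miss it is at most `2 ^ L / (t d)`. -/
theorem exists_sampler {k t L : ℕ} (hk : 0 < k) (hL : L ≠ 0) (hkL : k ≤ 2 ^ L) (ht : t ≤ 2 ^ L) :
    ∃ pos : Bits (2 * L) → Fin t → Fin k, ∀ D : Finset (Fin k),
      ((Finset.univ.filter fun s => ∀ j, pos s j ∉ D).card : ℝ) * (t * D.card) ≤
        2 ^ (2 * L) * 2 ^ L := by
  classical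
  have : Fact (Nat.Prime 2) := ⟨Nat.prime_two⟩
  let F := GaloisField 2 L
  have : Fintype F := Fintype.ofFinite F
  have hF : Fintype.card F = 2 ^ L := by
    rw [← Nat.card_eq_fintype_card]; exact GaloisField.card 2 L hL
  obtain ⟨u⟩ : Nonempty (Fin t ↪ F) :=
    Function.Embedding.nonempty_of_card_le (by simpa [hF] using ht)
  obtain ⟨g⟩ : Nonempty (Fin k ↪ F) :=
    Function.Embedding.nonempty_of_card_le (by simpa [hF] using hkL)
  have : Nonempty (Fin k) := ⟨⟨0, hk⟩⟩
  have e : Bits (2 * L) ≃ F × F := Fintype.equivOfCardEq (by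
    rw [Fintype.card_prod, hF]; simp; ring)
  refine ⟨fun s j => Function.invFun g ((e s).1 * u j + (e s).2), fun D => ?_⟩
  have h1 := card_affine_avoiding_le u.injective (D.map g)
  rw [Finset.card_map, hF] at h1
  have h2 : (Finset.univ.filter fun s =>
        ∀ j, Function.invFun g ((e s).1 * u j + (e s).2) ∉ D).card ≤
      (Finset.univ.filter fun c : F × F => ∀ j, c.1 * u j + c.2 ∉ D.map g).card := by
    rw [← Finset.card_map e.toEmbedding]
    refine Finset.card_le_card fun c hc => ?_
    obtain ⟨s, hs, rfl⟩ := Finset.mem_map.mp hc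
    refine Finset.mem_filter.mpr ⟨Finset.mem_univ _, fun j hj => ?_⟩
    obtain ⟨i, hi, hij⟩ := Finset.mem_map.mp hj
    refine (Finset.mem_filter.mp hs).2 j ?_
    have hij' : g i = (e s).1 * u j + (e s).2 := hij
    rw [← hij', Function.leftInverse_invFun g.injective]
    exact hi
  calc _ ≤ _ := mul_le_mul_of_nonneg_right (Nat.cast_le.mpr h2) (by positivity)
    _ ≤ _ := h1
    _ = _ := by push_cast; ring

/-! ### Real vectors and matrices on qubit registers -/

section Pad

variable {γ δ ε : Type} (σ : γ ≃ δ ⊕ ε)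

/-- The real vector `v`, extended by `0` to a register of which `δ` labels only a part of the
basis. -/
noncomputable def padVec (v : δ → ℝ) : γ → ℂ := fun s => Sum.elim (fun i => (v i : ℂ)) 0 (σ s)

/-- The real matrix `M`, extended by the identity on the rest of the register. -/
noncomputable def padMat [DecidableEq ε] (M : Matrix δ δ ℝ) : Matrix γ γ ℂ :=
  (fromBlocks (M.map (algebraMap ℝ ℂ)) 0 0 1).submatrix σ σ

theorem star_padVec_dotProduct [Fintype γ] [Fintype δ] [Fintype ε] (v w : δ → ℝ) :
    star (padVec σ v) ⬝ᵥ padVec σ w = ((v ⬝ᵥ w : ℝ) : ℂ) := by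
  have := Equiv.sum_comp σ fun z => star (Sum.elim (fun i => (v i : ℂ)) 0 z) *
    (Sum.elim (fun i => (w i : ℂ)) 0 z)
  simp only [dotProduct, padVec, Pi.star_apply, this]
  simp

variable [DecidableEq ε]

theorem conjTranspose_padMat (M : Matrix δ δ ℝ) : (padMat σ M)ᴴ = padMat σ Mᵀ := by
  rw [padMat, conjTranspose_submatrix, fromBlocks_conjTranspose, padMat]
  congr 2
  · ext i j; simp
  · simp
  · simp
  · simp

theorem padMat_one [DecidableEq δ] [DecidableEq γ] : padMat σ (1 : Matrix δ δ ℝ) = 1 := by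
  rw [padMat, Matrix.map_one _ (map_zero _) (map_one _), fromBlocks_one, submatrix_one_equiv]

variable [Fintype γ] [Fintype δ] [Fintype ε]

theorem padMat_mul (M N : Matrix δ δ ℝ) : padMat σ M * padMat σ N = padMat σ (M * N) := by
  rw [padMat, padMat, padMat, submatrix_mul_equiv, fromBlocks_multiply, Matrix.map_mul]
  simp

theorem padMat_mulVec (M : Matrix δ δ ℝ) (v : δ → ℝ) :
    padMat σ M *ᵥ padVec σ v = padVec σ (M *ᵥ v) := by
  ext s
  have := Equiv.sum_comp σ fun z =>
    fromBlocks (M.map (algebraMap ℝ ℂ)) 0 0 (1 : Matrix ε ε ℂ) (σ s) z *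
    (Sum.elim (fun i => (v i : ℂ)) 0 z)
  simp only [mulVec, dotProduct, padVec, padMat, submatrix_apply, this]
  rcases σ s with i | i
  · simp
  · simp

end Pad

/-! ### The four-round protocol for the problem -/

theorem dotProduct_complement_mulVec {m d : ℕ} (E : Matrix (Fin d) (Fin m) ℝ) (u : Fin m → ℝ) :
    u ⬝ᵥ ((1 - Eᵀ * E) *ᵥ u) = l2norm u ^ 2 - l2norm (E *ᵥ u) ^ 2 := by
  rw [sub_mulVec, one_mulVec, dotProduct_sub, l2norm_sq_eq_dotProduct, l2norm_sq_eq_dotProduct,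
    ← mulVec_mulVec, dotProduct_mulVec u, vecMul_transpose]

theorem complement_mul_self {m d : ℕ} {E : Matrix (Fin d) (Fin m) ℝ} (hE : E * Eᵀ = 1) :
    (1 - Eᵀ * E) * (1 - Eᵀ * E) = 1 - Eᵀ * E := by
  have : Eᵀ * E * (Eᵀ * E) = Eᵀ * E := by
    rw [Matrix.mul_assoc, ← Matrix.mul_assoc E, hE, Matrix.one_mul]
  rw [mul_sub, sub_mul, sub_mul, this]
  simp

/-- A position where two strings differ, if there is one. -/
noncomputable def diffPos {t : ℕ} [NeZero t] (X Y : Bits t) : Fin t :=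
  open Classical in if h : ∃ j, X j ≠ Y j then h.choose else 0

theorem diffPos_spec {t : ℕ} [NeZero t] {X Y : Bits t} (h : ∃ j, X j ≠ Y j) :
    X (diffPos X Y) ≠ Y (diffPos X Y) := by
  rw [diffPos, dif_pos h]
  exact h.choose_spec

/-- If the shared random bits rarely miss the positions where `x` and `y` differ, then the parties
can find such a position and solve Raz's problem there. -/
theorem hasPublicCoinQProtocol_manyRaz {k m w b t q L : ℕ} (hm : 72 ≤ m) (hb : m ^ 2 ≤ 2 ^ b)
    (hk : 0 < k) (hL : L ≠ 0) (hkL : k ≤ 2 ^ L) (ht0 : t ≠ 0) (ht : t ≤ 2 ^ L) (hq : m ≤ 2 ^ q)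
    (htw : 6 * 2 ^ L ≤ t * w) :
    HasPublicCoinQProtocol (ManyRaz k m w b) 4 (t + (t + (q + (q + 0)))) (2 * L) := by
  obtain ⟨v, E, U, hv, hE, hU, hans⟩ := exists_readings (b := b) k w hm hb
  obtain ⟨pos, hpos⟩ := exists_sampler hk hL hkL ht
  have : NeZero t := ⟨ht0⟩
  have σ : Bits q ≃ Fin m ⊕ Fin (2 ^ q - m) := Fintype.equivOfCardEq (by simp; omega)
  have hvd : ∀ a i, v a i ⬝ᵥ v a i = 1 := fun a i => by
    rw [← l2norm_sq_eq_dotProduct, hv, one_pow]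
  let P : PublicCoinQProtocol (AliceInput k m b) (BobInput k m b) (2 * L) := fun s =>
    fourRoundProtocol (fun a j => a.x (pos s j)) (fun a' j => a'.y (pos s j))
      (fun a z => padVec σ (v a (pos s (diffPos (fun j => a.x (pos s j)) z))))
      (fun a z => by rw [star_padVec_dotProduct, hvd, Complex.ofReal_one])
      (fun a' z => padMat σ (U a' (pos s (diffPos z (fun j => a'.y (pos s j))))))
      (fun a' z => by rw [conjTranspose_padMat, padMat_mul, hU, padMat_one])
      (fun a z =>
        let F := E a (pos s (diffPos (fun j => a.x (pos s j)) z))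
        padMat σ (1 - Fᵀ * F))
      (fun a z => by
        rw [conjTranspose_padMat]
        simp)
      (fun a z => by
        simp only [padMat_mul, complement_mul_self (hE _ _)])
  have hP : ∀ s a a', (P s).acceptProb a a' (fun _ _ => 1) =
      let i := pos s (diffPos (fun j => a.x (pos s j)) (fun j => a'.y (pos s j)))
      1 - overlap (E a i) (U a' i) (v a i) ^ 2 := by
    intro s a a'
    simp only [P]
    rw [acceptProb_fourRoundProtocol]
    simp only [padMat_mulVec, star_padVec_dotProduct, Complex.ofReal_re,
      dotProduct_complement_mulVec, l2norm_mulVec_of_isometry (hU _ _), hv, overlap, one_pow]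
  have h01 : ∀ a a' i, overlap (E a i) (U a' i) (v a i) ^ 2 ≤ 1 := fun a a' i =>
    pow_le_one₀ (l2norm_nonneg _) (overlap_le_one (hE a i) (hU a' i) (hv a i))
  have hmiss : ∀ a a' ans, ManyRaz k m w b a a' ans →
      ((Finset.univ.filter fun s => ∀ j, pos s j ∉ Finset.univ.filter fun i => a.x i ≠ a'.y i).card
        : ℝ) ≤ 2 ^ (2 * L) / 6 := by
    intro a a' ans h
    have h1 := hpos (Finset.univ.filter fun i => a.x i ≠ a'.y i)
    rw [(hans a a' ans h).1] at h1
    have h2 : (6 : ℝ) * 2 ^ L ≤ t * w := by exact_mod_cast htw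
    have h3 := (mul_le_mul_of_nonneg_left h2 (Nat.cast_nonneg _)).trans h1
    rw [← mul_assoc] at h3
    have := le_of_mul_le_mul_right h3 (by positivity)
    linarith
  -- if a selected position is in the difference set, then so is the one that the parties choose
  have hhit : ∀ s (a : AliceInput k m b) (a' : BobInput k m b),
      ¬ (∀ j, pos s j ∉ Finset.univ.filter fun i => a.x i ≠ a'.y i) →
      a.x (pos s (diffPos (fun j => a.x (pos s j)) (fun j => a'.y (pos s j)))) ≠
        a'.y (pos s (diffPos (fun j => a.x (pos s j)) (fun j => a'.y (pos s j)))) := by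
    intro s a a' h
    push Not at h
    obtain ⟨j, hj⟩ := h
    exact diffPos_spec (X := fun j => a.x (pos s j)) (Y := fun j => a'.y (pos s j))
      ⟨j, (Finset.mem_filter.mp hj).2⟩
  refine ⟨P, fun s => ⟨rfl, le_rfl⟩, fun a a' => ⟨fun h => ?_, fun h => ?_⟩⟩
  · have hm := hmiss a a' _ h
    rw [PublicCoinQProtocol.acceptProb, le_div_iff₀ (by positivity)]
    -- `143 / 144 = 1 - (1 / 12) ^ 2` bounds the acceptance probability unless `s` misses
    have h1 : ∀ s ∈ (Finset.univ : Finset (Bits (2 * L))), (143 / 144 : ℝ) -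
        (if ∀ j, pos s j ∉ Finset.univ.filter fun i => a.x i ≠ a'.y i then 1 else 0) ≤
        (P s).acceptProb a a' (fun _ _ => 1) := by
      intro s _
      rw [hP]
      split_ifs with hs
      · have := h01 a a' (pos s (diffPos (fun j => a.x (pos s j)) (fun j => a'.y (pos s j))))
        dsimp only
        linarith
      · have h2 := (hans a a' _ h).2 _ (hhit s a a' hs)
        simp only [if_true] at h2
        have := pow_le_pow_left₀ (l2norm_nonneg _) h2 2
        dsimp only [overlap] at this ⊢
        linarith
    have h2 := Finset.sum_le_sum h1
    rw [Finset.sum_sub_distrib, Finset.sum_boole] at h2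
    simp only [Finset.sum_const, Finset.card_univ, nsmul_eq_mul, Fintype.card_pi, Fintype.card_bool,
      Finset.prod_const, Fintype.card_fin, Nat.cast_pow, Nat.cast_ofNat] at h2
    have : (0 : ℝ) < 2 ^ (2 * L) := by positivity
    linarith
  · have hm := hmiss a a' _ h
    rw [PublicCoinQProtocol.acceptProb, div_le_iff₀ (by positivity)]
    -- `23 / 144 = 1 - (11 / 12) ^ 2` bounds the acceptance probability unless `s` misses
    have h1 : ∀ s ∈ (Finset.univ : Finset (Bits (2 * L))), (P s).acceptProb a a' (fun _ _ => 1) ≤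
        (23 / 144 : ℝ) +
        (if ∀ j, pos s j ∉ Finset.univ.filter fun i => a.x i ≠ a'.y i then 1 else 0) := by
      intro s _
      rw [hP]
      split_ifs with hs
      · refine (sub_le_self _ (sq_nonneg _)).trans ?_
        norm_num
      · have h2 := (hans a a' _ h).2 _ (hhit s a a' hs)
        simp only [Bool.false_eq_true, if_false] at h2
        have := pow_le_pow_left₀ (by norm_num) h2 2
        dsimp only
        linarith
    have h2 := Finset.sum_le_sum h1
    rw [Finset.sum_add_distrib, Finset.sum_boole] at h2
    simp only [Finset.sum_const, Finset.card_univ, nsmul_eq_mul, Fintype.card_pi, Fintype.card_bool,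
      Finset.prod_const, Fintype.card_fin, Nat.cast_pow, Nat.cast_ofNat] at h2
    have : (0 : ℝ) < 2 ^ (2 * L) := by positivity
    linarith

/-! ### The SMP protocol for the problem -/

/-- The index set of the vectors whose inner product adds up the squared overlaps. -/
abbrev OverlapIndex (k m : ℕ) : Type :=
  Fin k × Bool × (Fin m × Fin m) × (Fin m × Fin m)

/-- Alice's vector `⨁ i, e (x i) ⊗ (E i)ᵀ (E i) ⊗ (v i) (v i)ᵀ`, before normalization. -/
def aliceVector {k m d : ℕ} (x : Fin k → Bool) (E : Fin k → Matrix (Fin d) (Fin m) ℝ)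
    (v : Fin k → Fin m → ℝ) : OverlapIndex k m → ℝ := fun z =>
  if z.2.1 = x z.1 then ((E z.1)ᵀ * E z.1) z.2.2.1.1 z.2.2.1.2 * (v z.1 z.2.2.2.1 * v z.1 z.2.2.2.2)
    else 0

/-- Bob's vector `⨁ i, e (¬ y i) ⊗ U i ⊗ U i`, before normalization; the tensor factors are ordered
so that the two row indices of the copies of `U i` meet the projection `(E i)ᵀ (E i)` of Alice, and
the two column indices meet her vectors `v i`. -/
def bobVector {k m : ℕ} (y : Fin k → Bool) (U : Fin k → Matrix (Fin m) (Fin m) ℝ) :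
    OverlapIndex k m → ℝ := fun z =>
  if z.2.1 = !(y z.1) then U z.1 z.2.2.1.1 z.2.2.2.1 * U z.1 z.2.2.1.2 z.2.2.2.2 else 0

section Vectors

variable {k m d : ℕ} {x y : Fin k → Bool} {E : Fin k → Matrix (Fin d) (Fin m) ℝ}
  {v : Fin k → Fin m → ℝ} {U : Fin k → Matrix (Fin m) (Fin m) ℝ}

theorem sum_sq_entries {κ ν : Type} [Fintype κ] [Fintype ν] (M : Matrix κ ν ℝ) :
    ∑ i, ∑ j, M i j ^ 2 = (M * Mᵀ).trace := by
  simp [trace, mul_apply, sq]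

theorem sum_sq_projection {E : Matrix (Fin d) (Fin m) ℝ} (hE : E * Eᵀ = 1) :
    ∑ p, ∑ q, (Eᵀ * E) p q ^ 2 = d := by
  rw [sum_sq_entries, transpose_mul, transpose_transpose, Matrix.mul_assoc, ← Matrix.mul_assoc E,
    hE, Matrix.one_mul, trace_mul_comm, hE]
  simp

theorem sum_sq_aliceVector (hE : ∀ i, E i * (E i)ᵀ = 1) (hv : ∀ i, l2norm (v i) = 1) :
    ∑ z, aliceVector x E v z ^ 2 = k * d := by
  have hv' : ∀ i, ∑ p, v i p ^ 2 = 1 := fun i => by rw [← l2norm_sq, hv, one_pow]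
  simp only [aliceVector, Fintype.sum_prod_type, ite_pow, mul_pow, ne_eq, OfNat.ofNat_ne_zero,
    not_false_eq_true, zero_pow]
  have : ∀ i, ∑ c, ∑ p, ∑ q, ∑ p', ∑ q', (if c = x i then
      ((E i)ᵀ * E i) p q ^ 2 * (v i p' ^ 2 * v i q' ^ 2) else 0) = (d : ℝ) := by
    intro i
    rw [Finset.sum_eq_single (x i)]
    · simp only [if_true, ← Finset.mul_sum, hv', mul_one]
      exact sum_sq_projection (hE i)
    · intro c _ hc
      simp [hc]
    · simp
  rw [Finset.sum_congr rfl fun i _ => this i]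
  simp

theorem sum_sq_bobVector (hU : ∀ i, (U i)ᵀ * U i = 1) :
    ∑ z, bobVector y U z ^ 2 = k * m ^ 2 := by
  have hU' : ∀ i, ∑ p, ∑ q, U i p q ^ 2 = m := fun i => by
    rw [sum_sq_entries, trace_mul_comm, hU]; simp
  simp only [bobVector, Fintype.sum_prod_type, ite_pow, mul_pow, ne_eq, OfNat.ofNat_ne_zero,
    not_false_eq_true, zero_pow]
  have : ∀ i, ∑ c, ∑ p, ∑ p', ∑ q, ∑ q', (if c = !(y i) then
      U i p q ^ 2 * U i p' q' ^ 2 else 0) = (m : ℝ) ^ 2 := by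
    intro i
    rw [Finset.sum_eq_single (!(y i))]
    · simp only [if_true, ← Finset.mul_sum, ← Finset.sum_mul, hU', sq (m : ℝ)]
    · intro c _ hc
      simp [hc]
    · simp
  rw [Finset.sum_congr rfl fun i _ => this i]
  simp

theorem sum_aliceVector_mul_bobVector :
    ∑ z, aliceVector x E v z * bobVector y U z =
      ∑ i ∈ Finset.univ.filter (fun i => x i ≠ y i), overlap (E i) (U i) (v i) ^ 2 := by
  simp only [aliceVector, bobVector, Fintype.sum_prod_type, Finset.sum_filter]
  refine Finset.sum_congr rfl fun i _ => ?_
  rw [Finset.sum_eq_single (x i)]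
  · by_cases h : x i = y i
    · simp [h]
    · have h' : x i = !(y i) := by cases hx : x i <;> cases hy : y i <;> simp_all
      rw [if_pos h]
      simp only [if_true, if_pos h']
      have h1 : ∀ p p', ∑ q, ∑ q', ((E i)ᵀ * E i) p p' * (v i q * v i q') * (U i p q * U i p' q') =
          (U i *ᵥ v i) p * (((E i)ᵀ * E i) p p' * (U i *ᵥ v i) p') := by
        intro p p'
        simp only [mulVec, dotProduct, Finset.mul_sum, Finset.sum_mul]
        rw [Finset.sum_comm]
        exact Finset.sum_congr rfl fun q _ => Finset.sum_congr rfl fun q' _ => by ring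
      simp only [h1]
      have h2 : (U i *ᵥ v i) ⬝ᵥ (((E i)ᵀ * E i) *ᵥ (U i *ᵥ v i)) =
          overlap (E i) (U i) (v i) ^ 2 := by
        rw [← mulVec_mulVec, dotProduct_mulVec, vecMul_transpose, overlap, l2norm_sq_eq_dotProduct]
      rw [← h2]
      simp only [dotProduct, mulVec, Finset.mul_sum]
  · intro c _ hc
    simp [hc]
  · simp

end Vectors

/-- The normalized vectors of the parties have inner product about `w / (k m √(m / 2))` if the
answer is `0`, and almost `0` if it is `1`. -/
theorem qPar_manyRaz_le {k m w b : ℕ} (hm : 72 ≤ m) (hb : m ^ 2 ≤ 2 ^ b) (hk : 0 < k)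
    (hkm : k ≤ 2 ^ (m + 1)) (hkw : k ≤ m * w) :
    QPar (ManyRaz k m w b) ≤ ((144 * m ^ 11 : ℕ) : ℕ∞) := by
  obtain ⟨v, E, U, hv, hE, hU, hans⟩ := exists_readings (b := b) k w hm hb
  have hk0 : (0 : ℝ) < k := by exact_mod_cast hk
  have hm0 : (0 : ℝ) < m := by exact_mod_cast (by omega : 0 < m)
  have hd0 : (0 : ℝ) < (m / 2 : ℕ) := by exact_mod_cast (by omega : 0 < m / 2)
  have hw0 : (0 : ℝ) < w := by
    rcases Nat.eq_zero_or_pos w with h | h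
    · subst h; omega
    · exact_mod_cast h
  set d : ℝ := ((m / 2 : ℕ) : ℝ) with hd
  have hA : (0 : ℝ) < k * d := by positivity
  have hB : (0 : ℝ) < k * m ^ 2 := by positivity
  let a : AliceInput k m b → OverlapIndex k m → ℝ := fun a z =>
    aliceVector a.x (E a) (v a) z / √(k * d)
  let a' : BobInput k m b → OverlapIndex k m → ℝ := fun a' z =>
    bobVector a'.y (U a') z / √(k * m ^ 2)
  have hip : ∀ X Y, (∑ z, a X z * a' Y z) ^ 2 =
      (∑ i ∈ Finset.univ.filter (fun i => X.x i ≠ Y.y i),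
        overlap (E X i) (U Y i) (v X i) ^ 2) ^ 2 / ((k * d) * (k * m ^ 2)) := by
    intro X Y
    have : ∑ z, a X z * a' Y z = (∑ z, aliceVector X.x (E X) (v X) z * bobVector Y.y (U Y) z) /
        (√(k * d) * √(k * m ^ 2)) := by
      rw [Finset.sum_div]
      exact Finset.sum_congr rfl fun z _ => by simp only [a, a']; rw [div_mul_div_comm]
    rw [this, sum_aliceVector_mul_bobVector, div_pow, mul_pow, Real.sq_sqrt hA.le,
      Real.sq_sqrt hB.le]
  have hcard : Fintype.card (OverlapIndex k m) ≤ 2 ^ (6 * m) := by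
    simp only [Fintype.card_prod, Fintype.card_fin, Fintype.card_bool]
    have h1 : m ≤ 2 ^ m := Nat.lt_two_pow_self.le
    calc k * (2 * (m * m * (m * m)))
        ≤ 2 ^ (m + 1) * (2 * (2 ^ m * 2 ^ m * (2 ^ m * 2 ^ m))) := by gcongr
      _ = 2 ^ (5 * m + 2) := by ring
      _ ≤ _ := Nat.pow_le_pow_right two_pos (by omega)
  set γ : ℝ := (w : ℝ) ^ 2 / ((k * d) * (k * m ^ 2)) with hγ
  have hγ0 : 0 < γ := by positivity
  -- the gap is at least `1 / m ^ 5`, which determines the number `12 m ^ 10` of copies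
  have hgap : 1 ≤ (m : ℝ) ^ 5 * (6 / 10 * γ - γ / 10) := by
    have h2 : d ≤ m / 2 := Nat.cast_div_le
    have h3 : (k : ℝ) ≤ m * w := by exact_mod_cast hkw
    have h4 : (k : ℝ) ^ 2 ≤ (m * w) ^ 2 := pow_le_pow_left₀ hk0.le h3 2
    have h5 : (m : ℝ) ^ 5 * (6 / 10 * γ - γ / 10) =
        ((m : ℝ) ^ 5 * w ^ 2) / (2 * ((k * d) * (k * m ^ 2))) := by
      rw [hγ]; field_simp; ring
    rw [h5, one_le_div (by positivity)]
    calc 2 * (((k : ℝ) * d) * ((k : ℝ) * (m : ℝ) ^ 2)) =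
            (k : ℝ) ^ 2 * (2 * d) * (m : ℝ) ^ 2 := by ring
      _ ≤ ((m : ℝ) * w) ^ 2 * m * (m : ℝ) ^ 2 := by gcongr; linarith
      _ = _ := by ring
  have hq := qPar_le_of_inner_gap (ManyRaz k m w b) (d := 6 * m) hcard a a' (lo := γ / 10)
    (hi := 6 / 10 * γ) (r := 12 * m ^ 10) ?_ ?_ (by linarith) ?_ ?_ ?_
  · refine hq.trans_eq ?_
    congr 1
    ring
  · intro X
    simp only [a, div_pow, ← Finset.sum_div, sum_sq_aliceVector (hE X) (hv X), Real.sq_sqrt hA.le]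
    exact div_self hA.ne'
  · intro Y
    simp only [a', div_pow, ← Finset.sum_div, sum_sq_bobVector (hU Y), Real.sq_sqrt hB.le]
    exact div_self hB.ne'
  · intro X Y h
    obtain ⟨hw, ho⟩ := hans X Y true h
    rw [hip, hγ, div_right_comm]
    have h1 : ∑ i ∈ Finset.univ.filter (fun i => X.x i ≠ Y.y i),
        overlap (E X i) (U Y i) (v X i) ^ 2 ≤ w * (1 / 144) := by
      rw [← hw, ← nsmul_eq_mul, ← Finset.sum_const]
      refine Finset.sum_le_sum fun i hi => ?_
      have h2 := ho i (Finset.mem_filter.mp hi).2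
      simp only [if_true] at h2
      exact (pow_le_pow_left₀ (l2norm_nonneg _) h2 2).trans (by norm_num)
    refine div_le_div_of_nonneg_right ?_ (by positivity)
    refine (pow_le_pow_left₀ (Finset.sum_nonneg fun _ _ => sq_nonneg _) h1 2).trans ?_
    have : (0 : ℝ) < (w : ℝ) ^ 2 := by positivity
    nlinarith
  · intro X Y h
    obtain ⟨hw, ho⟩ := hans X Y false h
    rw [hip, hγ, ← mul_div_assoc]
    have h1 : w * (121 / 144) ≤ ∑ i ∈ Finset.univ.filter (fun i => X.x i ≠ Y.y i),
        overlap (E X i) (U Y i) (v X i) ^ 2 := by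
      rw [← hw, ← nsmul_eq_mul, ← Finset.sum_const]
      refine Finset.sum_le_sum fun i hi => ?_
      have h2 := ho i (Finset.mem_filter.mp hi).2
      simp only [Bool.false_eq_true, if_false] at h2
      have h3 := pow_le_pow_left₀ (by norm_num) h2 2
      linarith
    suffices h2 : 6 / 10 * (w : ℝ) ^ 2 ≤ (∑ i ∈ Finset.univ.filter (fun i => X.x i ≠ Y.y i),
        overlap (E X i) (U Y i) (v X i) ^ 2) ^ 2 from div_le_div_of_nonneg_right h2 (by positivity)
    refine le_trans ?_ (pow_le_pow_left₀ (by positivity : (0 : ℝ) ≤ w * (121 / 144)) h1 2)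
    have : (0 : ℝ) < (w : ℝ) ^ 2 := by positivity
    nlinarith
  · have h1 := pow_le_pow_left₀ zero_le_one hgap 2
    push_cast
    nlinarith

/-! ### Parameters -/

theorem rpow_two_ge_linear {x : ℝ} (hx : 512 ≤ x) : 32 * x ≤ (2 : ℝ) ^ x := by
  have h1 : x / 4 + 1 ≤ Real.exp (x / 4) := Real.add_one_le_exp _
  have h2 : Real.exp (x / 4) ^ 2 ≤ (2 : ℝ) ^ x := by
    rw [Real.rpow_def_of_pos two_pos, ← Real.exp_nat_mul]
    apply Real.exp_le_exp.mpr
    have := Real.log_two_gt_d9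
    push_cast
    nlinarith
  have h3 := pow_le_pow_left₀ (by linarith) h1 2
  nlinarith

theorem exists_logb_logb_ge (B : ℝ) : ∃ k₀ : ℕ, ∀ k : ℕ, k₀ ≤ k → B ≤ Real.logb 2 (Real.logb 2 k) :=
  Filter.eventually_atTop.mp ((((Real.tendsto_logb_atTop one_lt_two).comp
    (Real.tendsto_logb_atTop one_lt_two)).comp tendsto_natCast_atTop_atTop).eventually_ge_atTop B)

theorem two_pow_clog_le {n : ℕ} (hn : 1 < n) : 2 ^ Nat.clog 2 n ≤ 2 * n := by
  have h1 := Nat.pow_pred_clog_lt_self one_lt_two hn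
  have h2 : 0 < Nat.clog 2 n := Nat.clog_pos one_lt_two hn
  calc 2 ^ Nat.clog 2 n = 2 * 2 ^ (Nat.clog 2 n).pred := by
        rw [← pow_succ', ← Nat.succ_eq_add_one, Nat.succ_pred_eq_of_pos h2]
    _ ≤ _ := by omega

/-- The size of `clog n`, when `n ≤ 2 ^ e * x`. -/
theorem clog_le_logb_add {n e : ℕ} (hn : 1 < n) {x : ℝ} (hx : 0 < x) (h : (n : ℝ) ≤ 2 ^ e * x) :
    (Nat.clog 2 n : ℝ) ≤ Real.logb 2 x + (e + 1) := by
  have h1 : (2 : ℝ) ^ Nat.clog 2 n ≤ 2 ^ (e + 1) * x := by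
    have : (2 : ℝ) ^ Nat.clog 2 n ≤ 2 * n := by exact_mod_cast two_pow_clog_le hn
    rw [pow_succ]
    linarith
  have h2 := Real.logb_le_logb_of_le one_lt_two (by positivity) h1
  rw [Real.logb_mul (by positivity) hx.ne', Real.logb_pow, Real.logb_pow,
    Real.logb_self_eq_one one_lt_two] at h2
  push_cast at h2
  linarith

theorem mainTheorem9 (c : ℕ) (hc : 2 ≤ c) :
    ∃ C k₀ : ℕ, ∀ k m w b n : ℕ, k₀ ≤ k →
      Even m → |(m : ℝ) - Real.logb 2 k| ≤ 1 →
      |(w : ℝ) - k / Real.logb 2 (Real.logb 2 k)| < 1 →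
      b = c * Nat.clog 2 m → n = inputLength k m b →
      -- on the promise, the answer is a Boolean function of the inputs
      (∀ x y, ¬ (ManyRaz k m w b x y false ∧ ManyRaz k m w b x y true)) ∧
      -- four rounds, `O(log log n)` qubits, `O(log n)` shared random bits
      (∃ q ℓ : ℕ, (q : ℝ) ≤ C * Real.logb 2 (Real.logb 2 n) ∧ (ℓ : ℝ) ≤ C * Real.logb 2 n ∧
        HasPublicCoinQProtocol (ManyRaz k m w b) 4 q ℓ) ∧
      -- `Q^∥(f) ≤ (log n)^C`
      (∃ q : ℕ, (q : ℝ) ≤ (Real.logb 2 n) ^ C ∧ QPar (ManyRaz k m w b) ≤ q) := by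
  obtain ⟨k₀, hk₀⟩ := exists_logb_logb_ge 512
  refine ⟨60, k₀, fun k m w b n hk _ hm hw hb hn => ?_⟩
  have hG := hk₀ k hk
  set K := Real.logb 2 k with hKdef
  set G := Real.logb 2 K with hGdef
  have hk1 : 0 < k := by
    rcases Nat.eq_zero_or_pos k with h | h
    · rw [hGdef, hKdef, h] at hG
      norm_num at hG
    · exact h
  have hk1' : (1 : ℝ) ≤ k := by exact_mod_cast hk1
  have hK0 : 0 < K := by
    refine (Real.logb_nonneg one_lt_two hk1').lt_of_ne fun h => ?_
    rw [hGdef, hKdef, ← h] at hG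
    norm_num at hG
  have hGK : (2 : ℝ) ^ G = K := Real.rpow_logb two_pos (by norm_num) hK0
  have hKk : (2 : ℝ) ^ K = k := Real.rpow_logb two_pos (by norm_num) (by linarith)
  have hKG : 32 * G ≤ K := hGK ▸ rpow_two_ge_linear hG
  have hkK : 32 * K ≤ k := hKk ▸ rpow_two_ge_linear (by linarith)
  obtain ⟨hm1, hm2⟩ := abs_le.mp hm
  have hm72 : 72 ≤ m := by
    have : (72 : ℝ) ≤ m := by linarith
    exact_mod_cast this
  have hkn : (k : ℝ) ≤ n := by
    rw [hn, inputLength]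
    exact_mod_cast Nat.le_add_right k _
  have hKn : K ≤ Real.logb 2 n := Real.logb_le_logb_of_le one_lt_two (by linarith) hkn
  have hGn : G ≤ Real.logb 2 (Real.logb 2 n) := Real.logb_le_logb_of_le one_lt_two hK0 hKn
  have hb2 : m ^ 2 ≤ 2 ^ b := by
    rw [hb, mul_comm, pow_mul]
    calc m ^ 2 ≤ m ^ c := Nat.pow_le_pow_right (by omega) hc
      _ ≤ _ := Nat.pow_le_pow_left (Nat.le_pow_clog one_lt_two m) c
  have hwk : (k : ℝ) ≤ 2 * G * w := by
    have h1 := (abs_lt.mp hw).1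
    have h2 : (k : ℝ) / G * G = k := div_mul_cancel₀ _ (by linarith)
    nlinarith
  have hw0 : 0 < w := by
    rcases Nat.eq_zero_or_pos w with h | h
    · rw [h] at hwk
      norm_num at hwk
      linarith
    · exact h
  refine ⟨?_, ?_, ?_⟩
  · rintro x y ⟨h0, h1⟩
    obtain ⟨v, E, U, -, -, -, hans⟩ := exists_readings (b := b) k w hm72 hb2
    obtain ⟨hcard, h0⟩ := hans x y _ h0
    have h1 := (hans x y _ h1).2
    obtain ⟨i, hi⟩ := Finset.card_pos.mp (hcard ▸ hw0)
    have hi' := (Finset.mem_filter.mp hi).2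
    have h0 := h0 i hi'
    have h1 := h1 i hi'
    simp only [if_true, Bool.false_eq_true, if_false] at h0 h1
    linarith
  · have hk2 : 1 < k := by
      have : (1 : ℝ) < k := by linarith
      exact_mod_cast this
    have hL := clog_le_logb_add (e := 0) hk2 (x := k) (by linarith) (by simp)
    have hq := clog_le_logb_add (e := 1) (by omega : 1 < m) hK0 (by linarith)
    rw [← hKdef] at hL
    rw [← hGdef] at hq
    have hkL : k ≤ 2 ^ Nat.clog 2 k := Nat.le_pow_clog one_lt_two k
    have ht1 := Nat.le_ceil (24 * G)
    have ht2 := Nat.ceil_lt_add_one (a := 24 * G) (by linarith)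
    push_cast at hL hq
    refine ⟨_, _, ?_, ?_, hasPublicCoinQProtocol_manyRaz (t := ⌈24 * G⌉₊) (q := Nat.clog 2 m)
      (L := Nat.clog 2 k) hm72 hb2 hk1 (Nat.clog_pos one_lt_two hk2).ne' hkL ?_ ?_
      (Nat.le_pow_clog one_lt_two m) ?_⟩
    · push_cast
      linarith
    · push_cast
      linarith
    · exact (Nat.ceil_pos.mpr (by linarith)).ne'
    · refine le_trans ?_ hkL
      have : (⌈24 * G⌉₊ : ℝ) ≤ k := by linarith
      exact_mod_cast this
    · -- a position is hit unless an event of probability at most `2 k / (t w) ≤ 1 / 6` occurs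
      have h1 : ((2 ^ Nat.clog 2 k : ℕ) : ℝ) ≤ 2 * k := by exact_mod_cast two_pow_clog_le hk2
      have h2 : 24 * G * w ≤ ⌈24 * G⌉₊ * w := mul_le_mul_of_nonneg_right ht1 (Nat.cast_nonneg w)
      have : ((6 * 2 ^ Nat.clog 2 k : ℕ) : ℝ) ≤ ((⌈24 * G⌉₊ * w : ℕ) : ℝ) := by
        rw [Nat.cast_mul, Nat.cast_mul, Nat.cast_ofNat]
        linarith
      exact_mod_cast this
  · refine ⟨144 * m ^ 11, ?_, qPar_manyRaz_le hm72 hb2 hk1 ?_ ?_⟩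
    · refine le_trans ?_ (pow_le_pow_left₀ hK0.le hKn 60)
      have hK1 : 16384 ≤ K := by linarith
      have h1 : (m : ℝ) ≤ 2 * K := by linarith
      have h2 : (16384 : ℝ) ^ 49 ≤ K ^ 49 := pow_le_pow_left₀ (by norm_num) hK1 49
      push_cast
      calc 144 * (m : ℝ) ^ 11 ≤ 144 * (2 * K) ^ 11 := by gcongr
        _ = (144 * 2 ^ 11) * K ^ 11 := by ring
        _ ≤ K ^ 49 * K ^ 11 :=
            mul_le_mul_of_nonneg_right (le_trans (by norm_num) h2) (by positivity)
        _ = K ^ 60 := by ring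
    · have : (k : ℝ) ≤ 2 ^ (m + 1) := by
        rw [← hKk, ← Real.rpow_natCast]
        exact Real.rpow_le_rpow_of_exponent_le one_le_two (by push_cast; linarith)
      exact_mod_cast this
    · have : (k : ℝ) ≤ m * w :=
        hwk.trans (mul_le_mul_of_nonneg_right (by linarith) (Nat.cast_nonneg w))
      exact_mod_cast this
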